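/- Let $n\ge 1$, let $A$ and $B$ be associative rings with identity, let $U$ be a $(B,A)$-bimodule, and let $\Lambda=\begin{pmatrix}A&0\\U&B\end{pmatrix}$ be the formal triangular matrix ring. Modules are left modules unless stated otherwise, and all classes of modules are closed under isomorphisms. A $\Lambda$-module $M$ is identified with a triple $\begin{pmatrix}M_1\\M_2\end{pmatrix}_{\varphi}$, where $M_1$ is an $A$-module, $M_2$ is a $B$-module and $\varphi:U\otimes_A M_1\to M_2$ is $B$-linear; let $\widetilde\varphi:M_1\to\operatorname{Hom}_B(U,M_2)$ be the adjoint $A$-linear map. For a class $\mathcal X$ of $R$-modules and $m\ge 0$, let $\mathcal X^\wedge_m$ (resp. $\mathcal X^\vee_m$) be the class of modules $M$ for which there is an exact sequence $0\to X_k\to\cdots\to X_0\to M\to 0$ (resp. $0\to M\to X_0\to\cdots\to X_k\to 0$) with $0\le k\le m$ and all $X_i\in\mathcal X$. A pair $(\mathcal X,\mathcal Y)$ of classes of $R$-modules is a *left $n$-cotorsion pair* over $R$ if $\mathcal X$ is closed under direct summands, $\operatorname{Ext}^i_R(X,Y)=0$ for all $X\in\mathcal X$, $Y\in\mathcal Y$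 and $1\le i\le n$, and for every $R$-module $M$ there is a short exact sequence $0\to Y\to X\to M\to 0$ with $X\in\mathcal X$ and $Y\in\mathcal Y^\wedge_{n-1}$. It is a *right $n$-cotorsion pair* over $R$ if $\mathcal Y$ is closed under direct summands, $\operatorname{Ext}^i_R(X,Y)=0$ for all $X\in\mathcal X$, $Y\in\mathcal Y$ and $1\le i\le n$, and for every $R$-module $M$ there is a short exact sequence $0\to M\to Y\to X\to 0$ with $Y\in\mathcal Y$ and $X\in\mathcal X^\vee_{n-1}$. For a class $\mathcal X$ of $A$-modules and a class $\mathcal Y$ of $B$-modules, define classes of $\Lambda$-modules as follows: $\mathfrak A^{\mathcal X}_{\mathcal Y}$ consists of all $M$ with $M_1\in\mathcal X$ and $M_2\in\mathcal Y$; $\mathfrak P^{\mathcal X}_{\mathcal Y}$ of all $M$ with $M_1\in\mathcal X$, $\operatorname{Coker}\varphi\in\mathcal Y$ and $\varphi$ a monomorphism; $\mathfrak I^{\mathcal X}_{\mathcal Y}$ of all $M$ with $\operatorname{Ker}\widetilde\varphi\in\mathcal X$, $M_2\in\mathcal Y$ and $\widetilde\varphi$ an epimorphism. **Theorem.** Let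 $\mathcal C,\mathcal D$ be classes of $A$-modules and $\mathcal E,\mathcal F$ classes of $B$-modules. (1) Assume that $(\mathfrak P^{\mathcal C}_{\mathcal E},\mathfrak A^{\mathcal D}_{\mathcal F})$ is a right $n$-cotorsion pair over $\Lambda$ and that $\operatorname{Tor}^A_j(U,C)=0$ for all $C\in\mathcal C$ and $1\le j\le n+1$. (a) Then $(\mathcal C,\mathcal D)$ is a right $n$-cotorsion pair over $A$. (b) If in addition $\mathcal E^\vee_{n-1}$ is closed under extensions and $U\otimes_A D\in\mathcal E^\vee_{n-1}$ for all $D\in\mathcal D$, then $(\mathcal E,\mathcal F)$ is a right $n$-cotorsion pair over $B$. (2) Assume that $(\mathfrak A^{\mathcal C}_{\mathcal E},\mathfrak I^{\mathcal D}_{\mathcal F})$ is a left $n$-cotorsion pair over $\Lambda$ and that $\operatorname{Ext}^j_B(U,F)=0$ for all $F\in\mathcal F$ and $1\le j\le n+1$. (a) Then $(\mathcal E,\mathcal F)$ is a left $n$-cotorsion pair over $B$. (b) If in addition $\mathcal D^\wedge_{n-1}$ is closed under extensions and $\operatorname{Hom}_B(U,E)\in\mathcal D^\wedge_{n-1}$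 for all $E\in\mathcal E$, then $(\mathcal C,\mathcal D)$ is a left $n$-cotorsion pair over $A$. -/

import Mathlib

open CategoryTheory MulOpposite TensorProduct

set_option linter.unusedSectionVars false

universe u

/-! ### Classes of modules, resolution dimensions, `n`-cotorsion pairs -/

section Cotorsion

variable {R : Type u} [Ring R]

/-- `M` has a `P`-resolution of length `m`: there is an exact sequence
`0 → X m → ⋯ → X 1 → X 0 → M → 0` with all `X i` in `P`. The sequence is indexed by all of `ℕ` and
is zero beyond `m`. -/
def HasResolution (P : ObjectProperty (ModuleCat.{u} R)) (m : ℕ) (M : ModuleCat.{u} R) : Prop :=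
  ∃ (X : ℕ → ModuleCat.{u} R) (d : ∀ i, X (i + 1) ⟶ X i) (ε : X 0 ⟶ M),
    (∀ i, i ≤ m → P (X i)) ∧ (∀ i, m < i → Subsingleton (X i)) ∧
    Function.Surjective ε ∧ Function.Exact (d 0) ε ∧ ∀ i, Function.Exact (d (i + 1)) (d i)

/-- `M` has a `P`-coresolution of length `m`: there is an exact sequence
`0 → M → X 0 → X 1 → ⋯ → X m → 0` with all `X i` in `P`. The sequence is indexed by all of `ℕ` and
is zero beyond `m`. -/
def HasCoresolution (P : ObjectProperty (ModuleCat.{u} R)) (m : ℕ) (M : ModuleCat.{u} R) : Prop :=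
  ∃ (X : ℕ → ModuleCat.{u} R) (d : ∀ i, X i ⟶ X (i + 1)) (η : M ⟶ X 0),
    (∀ i, i ≤ m → P (X i)) ∧ (∀ i, m < i → Subsingleton (X i)) ∧
    Function.Injective η ∧ Function.Exact η (d 0) ∧ ∀ i, Function.Exact (d i) (d (i + 1))

/-- The class `P^∧_m` of modules of `P`-resolution dimension at most `m`. -/
def resdimLE (P : ObjectProperty (ModuleCat.{u} R)) (m : ℕ) : ObjectProperty (ModuleCat.{u} R) :=
  fun M => ∃ k, k ≤ m ∧ HasResolution P k M

/-- The class `P^∨_m` of modules of `P`-coresolution dimension at most `m`. -/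
def coresdimLE (P : ObjectProperty (ModuleCat.{u} R)) (m : ℕ) : ObjectProperty (ModuleCat.{u} R) :=
  fun M => ∃ k, k ≤ m ∧ HasCoresolution P k M

/-- `P` is closed under direct summands. -/
def ClosedUnderSummands (P : ObjectProperty (ModuleCat.{u} R)) : Prop :=
  ∀ X Y Z : ModuleCat.{u} R, P Z → Nonempty (Z ≃ₗ[R] X × Y) → P X

/-- `(P, Q)` is a left `n`-cotorsion pair in the category of left `R`-modules. -/
structure IsLeftCotorsionPair (n : ℕ) (P Q : ObjectProperty (ModuleCat.{u} R)) : Prop where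
  summands : ClosedUnderSummands P
  ext_eq_zero : ∀ X Y : ModuleCat.{u} R, P X → Q Y → ∀ i, 1 ≤ i → i ≤ n →
    Subsingleton (Abelian.Ext X Y i)
  exists_sequence : ∀ M : ModuleCat.{u} R, ∃ (Y X : ModuleCat.{u} R) (f : Y ⟶ X) (g : X ⟶ M)
    (w : f ≫ g = 0), (ShortComplex.mk f g w).ShortExact ∧ P X ∧ resdimLE Q (n - 1) Y

/-- `(P, Q)` is a right `n`-cotorsion pair in the category of left `R`-modules. -/
structure IsRightCotorsionPair (n : ℕ) (P Q : ObjectProperty (ModuleCat.{u} R)) : Prop where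
  summands : ClosedUnderSummands Q
  ext_eq_zero : ∀ X Y : ModuleCat.{u} R, P X → Q Y → ∀ i, 1 ≤ i → i ≤ n →
    Subsingleton (Abelian.Ext X Y i)
  exists_sequence : ∀ M : ModuleCat.{u} R, ∃ (Y X : ModuleCat.{u} R) (f : M ⟶ Y) (g : Y ⟶ X)
    (w : f ≫ g = 0), (ShortComplex.mk f g w).ShortExact ∧ Q Y ∧ coresdimLE P (n - 1) X

end Cotorsion

/-! ### Tensor product with, and homomorphisms out of, a bimodule

A `(B, A)`-bimodule `U` is a left `B`-module with a commuting right `A`-action, i.e. a commuting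
`Aᵐᵒᵖ`-module structure; `op a • u` is `u a`. -/

section Bimodule

variable (A B U : Type u) [Ring A] [Ring B] [AddCommGroup U] [Module B U] [Module Aᵐᵒᵖ U]
  [SMulCommClass B Aᵐᵒᵖ U]

section Tensor

variable (X : Type u) [AddCommGroup X] [Module A X]

/-- The relations `u a ⊗ x = u ⊗ a x`. The set of generators is stable under `B`, so that its
`B`-span is the subgroup that it generates. -/
def balancedRel : Submodule B (U ⊗[ℤ] X) :=
  Submodule.span B {t | ∃ (u : U) (a : A) (x : X), t = (op a • u) ⊗ₜ[ℤ] x - u ⊗ₜ[ℤ] (a • x)}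

/-- The left `B`-module `U ⊗_A X`. -/
abbrev BimodTensor : Type u := (U ⊗[ℤ] X) ⧸ balancedRel A B U X

end Tensor

section Functoriality

variable {X Y : Type u} [AddCommGroup X] [Module A X] [AddCommGroup Y] [Module A Y]

lemma balancedRel_le_comap (f : X →ₗ[A] Y) :
    balancedRel A B U X ≤ (balancedRel A B U Y).comap
      (TensorProduct.AlgebraTensorModule.map (LinearMap.id : U →ₗ[B] U)
        (f.toAddMonoidHom.toIntLinearMap)) := by
  refine Submodule.span_le.2 ?_
  rintro _ ⟨u, a, x, rfl⟩
  refine Submodule.subset_span ⟨u, a, f x, ?_⟩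
  simp

/-- The map `1 ⊗ f : U ⊗_A X → U ⊗_A Y`. -/
def BimodTensor.map (f : X →ₗ[A] Y) : BimodTensor A B U X →ₗ[B] BimodTensor A B U Y :=
  Submodule.mapQ _ _ _ (balancedRel_le_comap A B U f)

@[simp]
lemma BimodTensor.map_mk_tmul (f : X →ₗ[A] Y) (u : U) (x : X) :
    BimodTensor.map A B U f (Submodule.Quotient.mk (u ⊗ₜ x)) =
      Submodule.Quotient.mk (u ⊗ₜ f x) := rfl

variable {A B U} in
lemma BimodTensor.hom_ext {Z : Type u} [AddCommGroup Z] [Module B Z]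
    {f g : BimodTensor A B U X →ₗ[B] Z}
    (h : ∀ u x, f (Submodule.Quotient.mk (u ⊗ₜ x)) = g (Submodule.Quotient.mk (u ⊗ₜ x))) :
    f = g := by
  refine Submodule.linearMap_qext _ (TensorProduct.AlgebraTensorModule.ext fun u x => ?_)
  exact h u x

end Functoriality

/-- The functor `U ⊗_A -` from left `A`-modules to left `B`-modules. -/
def bimodTensorFunctor : ModuleCat.{u} A ⥤ ModuleCat.{u} B where
  obj X := ModuleCat.of B (BimodTensor A B U X)
  map f := ModuleCat.ofHom (BimodTensor.map A B U f.hom)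
  map_id X := by
    refine ModuleCat.hom_ext (BimodTensor.hom_ext fun u x => ?_)
    rfl
  map_comp f g := by
    refine ModuleCat.hom_ext (BimodTensor.hom_ext fun u x => ?_)
    rfl

instance : (bimodTensorFunctor A B U).Additive where
  map_add {X Y f g} := by
    refine ModuleCat.hom_ext (BimodTensor.hom_ext fun u x => ?_)
    change (Submodule.Quotient.mk (u ⊗ₜ (f x + g x)) : BimodTensor A B U Y) = _
    rw [TensorProduct.tmul_add]
    rfl

/-- `Tor^A_j(U, X)`, the `j`-th left derived functor of `U ⊗_A -` at `X`, with the left `B`-module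
structure that it inherits from `U`. -/
noncomputable def bimodTor (j : ℕ) (X : ModuleCat.{u} A) : ModuleCat.{u} B :=
  ((bimodTensorFunctor A B U).leftDerived j).obj X

section Hom

variable {A B U} in
/-- Right multiplication by `a` on `U`, as a `B`-linear map. -/
def rightMul (a : A) : U →ₗ[B] U where
  toFun u := op a • u
  map_add' := smul_add _
  map_smul' b u := (smul_comm b (op a) u).symm

variable (Y : Type u) [AddCommGroup Y] [Module B Y]

/-- The left `A`-module `Hom_B(U, Y)`; the action is `(a f)(u) = f(u a)`. -/
def BimodHom : Type u := U →ₗ[B] Y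

instance : AddCommGroup (BimodHom B U Y) := inferInstanceAs (AddCommGroup (U →ₗ[B] Y))

instance : FunLike (BimodHom B U Y) U Y := inferInstanceAs (FunLike (U →ₗ[B] Y) U Y)

instance : Module A (BimodHom B U Y) where
  smul a f := LinearMap.comp (show U →ₗ[B] Y from f) (rightMul a)
  one_smul f := LinearMap.ext fun u => congrArg f (one_smul Aᵐᵒᵖ u)
  mul_smul a a' f := LinearMap.ext fun u => congrArg f (mul_smul (op a') (op a) u)
  smul_zero _ := rfl
  smul_add _ _ _ := rfl
  add_smul a a' f := LinearMap.ext fun u =>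
    (congrArg f (add_smul (op a) (op a') u)).trans (LinearMap.map_add f _ _)
  zero_smul f := LinearMap.ext fun u =>
    (congrArg f (zero_smul Aᵐᵒᵖ u)).trans (LinearMap.map_zero f)

variable {A B U Y} in
@[simp] lemma BimodHom.smul_apply (a : A) (f : BimodHom B U Y) (u : U) :
    (a • f) u = f (op a • u) := rfl

end Hom

end Bimodule

/-! ### The formal triangular matrix ring -/

/-- The formal triangular matrix `(a 0; u b)`. -/
@[ext]
structure TriMat (A B U : Type u) : Type u where
  a : A
  u : U
  b : B

namespace TriMat

variable {A B U : Type u} [Ring A] [Ring B] [AddCommGroup U] [Module B U] [Module Aᵐᵒᵖ U]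

instance : Add (TriMat A B U) := ⟨fun x y => ⟨x.a + y.a, x.u + y.u, x.b + y.b⟩⟩
instance : Zero (TriMat A B U) := ⟨⟨0, 0, 0⟩⟩
instance : Neg (TriMat A B U) := ⟨fun x => ⟨-x.a, -x.u, -x.b⟩⟩
instance : One (TriMat A B U) := ⟨⟨1, 0, 1⟩⟩
instance : Mul (TriMat A B U) :=
  ⟨fun x y => ⟨x.a * y.a, op y.a • x.u + x.b • y.u, x.b * y.b⟩⟩

@[simp] lemma add_a (x y : TriMat A B U) : (x + y).a = x.a + y.a := rfl
@[simp] lemma add_u (x y : TriMat A B U) : (x + y).u = x.u + y.u := rfl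
@[simp] lemma add_b (x y : TriMat A B U) : (x + y).b = x.b + y.b := rfl
@[simp] lemma neg_a (x : TriMat A B U) : (-x).a = -x.a := rfl
@[simp] lemma neg_u (x : TriMat A B U) : (-x).u = -x.u := rfl
@[simp] lemma neg_b (x : TriMat A B U) : (-x).b = -x.b := rfl
@[simp] lemma zero_a : (0 : TriMat A B U).a = 0 := rfl
@[simp] lemma zero_u : (0 : TriMat A B U).u = 0 := rfl
@[simp] lemma zero_b : (0 : TriMat A B U).b = 0 := rfl
@[simp] lemma one_a : (1 : TriMat A B U).a = 1 := rfl
@[simp] lemma one_u : (1 : TriMat A B U).u = 0 := rfl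
@[simp] lemma one_b : (1 : TriMat A B U).b = 1 := rfl
@[simp] lemma mul_a (x y : TriMat A B U) : (x * y).a = x.a * y.a := rfl
@[simp] lemma mul_u (x y : TriMat A B U) : (x * y).u = op y.a • x.u + x.b • y.u := rfl
@[simp] lemma mul_b (x y : TriMat A B U) : (x * y).b = x.b * y.b := rfl

variable [SMulCommClass B Aᵐᵒᵖ U]

/-- The formal triangular matrix ring, with matrix addition and multiplication. -/
instance : Ring (TriMat A B U) where
  add_assoc x y z := by ext <;> simp [add_assoc]
  zero_add x := by ext <;> simp
  add_zero x := by ext <;> simp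
  add_comm x y := by ext <;> simp [add_comm]
  neg_add_cancel x := by ext <;> simp
  left_distrib x y z := by
    ext
    · simp [mul_add]
    · simp only [mul_u, add_a, add_u, MulOpposite.op_add, add_smul, smul_add]; abel
    · simp [mul_add]
  right_distrib x y z := by
    ext
    · simp [add_mul]
    · simp only [mul_u, add_u, add_b, add_smul, smul_add]; abel
    · simp [add_mul]
  zero_mul x := by ext <;> simp
  mul_zero x := by ext <;> simp
  mul_assoc x y z := by
    ext
    · simp [mul_assoc]
    · simp only [mul_u, mul_a, mul_b, op_mul, mul_smul, smul_add, smul_comm x.b (op z.a) y.u]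
      abel
    · simp [mul_assoc]
  one_mul x := by ext <;> simp
  mul_one x := by ext <;> simp
  nsmul := nsmulRec
  zsmul := zsmulRec

variable (A B U) (M : Type u) [AddCommGroup M] [Module (TriMat A B U) M]

/-- The component `M₁ = e₁ M` of a left module over the triangular matrix ring, where
`e₁ = (1 0; 0 0)`. -/
def fst : AddSubgroup M where
  carrier := {m | (⟨1, 0, 0⟩ : TriMat A B U) • m = m}
  add_mem' {x y} hx hy := by
    simp only [Set.mem_ofPred_eq] at *
    rw [smul_add, hx, hy]
  zero_mem' := smul_zero _
  neg_mem' {x} hx := by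
    simp only [Set.mem_ofPred_eq] at *
    rw [smul_neg, hx]

/-- The component `M₂ = e₂ M` of a left module over the triangular matrix ring, where
`e₂ = (0 0; 0 1)`. -/
def snd : AddSubgroup M where
  carrier := {m | (⟨0, 0, 1⟩ : TriMat A B U) • m = m}
  add_mem' {x y} hx hy := by
    simp only [Set.mem_ofPred_eq] at *
    rw [smul_add, hx, hy]
  zero_mem' := smul_zero _
  neg_mem' {x} hx := by
    simp only [Set.mem_ofPred_eq] at *
    rw [smul_neg, hx]

variable {A B U M} in
lemma mem_fst {m : M} : m ∈ fst A B U M ↔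
    (⟨1, 0, 0⟩ : TriMat A B U) • m = m := Iff.rfl

variable {A B U M} in
lemma mem_snd {m : M} : m ∈ snd A B U M ↔
    (⟨0, 0, 1⟩ : TriMat A B U) • m = m := Iff.rfl

/-- `M₁` as a left `A`-module: `a` acts as `(a 0; 0 0)`. -/
instance : Module A (fst A B U M) where
  smul a m := ⟨(⟨a, 0, 0⟩ : TriMat A B U) • (m : M), by
    rw [mem_fst, ← mul_smul]
    congr 1
    ext <;> simp⟩
  one_smul m := Subtype.ext m.2
  mul_smul a a' m := Subtype.ext <| by
    change (⟨a * a', 0, 0⟩ : TriMat A B U) • (m : M) =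
      (⟨a, 0, 0⟩ : TriMat A B U) • (⟨a', 0, 0⟩ : TriMat A B U) • (m : M)
    rw [← mul_smul]
    congr 1
    ext <;> simp
  smul_zero a := Subtype.ext (smul_zero _)
  smul_add a m m' := Subtype.ext (smul_add _ _ _)
  add_smul a a' m := Subtype.ext <| by
    change (⟨a + a', 0, 0⟩ : TriMat A B U) • (m : M) =
      (⟨a, 0, 0⟩ : TriMat A B U) • (m : M) + (⟨a', 0, 0⟩ : TriMat A B U) • (m : M)
    rw [← add_smul]
    congr 1
    ext <;> simp
  zero_smul m := Subtype.ext (zero_smul (TriMat A B U) (m : M))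

/-- `M₂` as a left `B`-module: `b` acts as `(0 0; 0 b)`. -/
instance : Module B (snd A B U M) where
  smul b m := ⟨(⟨0, 0, b⟩ : TriMat A B U) • (m : M), by
    rw [mem_snd, ← mul_smul]
    congr 1
    ext <;> simp⟩
  one_smul m := Subtype.ext m.2
  mul_smul b b' m := Subtype.ext <| by
    change (⟨0, 0, b * b'⟩ : TriMat A B U) • (m : M) =
      (⟨0, 0, b⟩ : TriMat A B U) • (⟨0, 0, b'⟩ : TriMat A B U) • (m : M)
    rw [← mul_smul]
    congr 1
    ext <;> simp
  smul_zero b := Subtype.ext (smul_zero _)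
  smul_add b m m' := Subtype.ext (smul_add _ _ _)
  add_smul b b' m := Subtype.ext <| by
    change (⟨0, 0, b + b'⟩ : TriMat A B U) • (m : M) =
      (⟨0, 0, b⟩ : TriMat A B U) • (m : M) + (⟨0, 0, b'⟩ : TriMat A B U) • (m : M)
    rw [← add_smul]
    congr 1
    ext <;> simp
  zero_smul m := Subtype.ext (zero_smul (TriMat A B U) (m : M))

variable {A B U M} in
@[simp] lemma coe_smul_fst (a : A) (m : fst A B U M) :
    ((a • m : fst A B U M) : M) =
      (⟨a, 0, 0⟩ : TriMat A B U) • (m : M) := rfl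

variable {A B U M} in
@[simp] lemma coe_smul_snd (b : B) (m : snd A B U M) :
    ((b • m : snd A B U M) : M) =
      (⟨0, 0, b⟩ : TriMat A B U) • (m : M) := rfl

/-- The structure map `φ~ : M₁ → Hom_B(U, M₂)`, `φ~(m)(u) = (0 0; u 0) m`. -/
def adj : fst A B U M →ₗ[A]
    BimodHom B U (snd A B U M) where
  toFun m := show U →ₗ[B] snd A B U M from
    { toFun := fun u => ⟨(⟨0, u, 0⟩ : TriMat A B U) • (m : M), by
        rw [mem_snd, ← mul_smul]
        congr 1
        ext <;> simp⟩
      map_add' := fun u u' => Subtype.ext <| by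
        change (⟨0, u + u', 0⟩ : TriMat A B U) • (m : M) =
          (⟨0, u, 0⟩ : TriMat A B U) • (m : M) + (⟨0, u', 0⟩ : TriMat A B U) • (m : M)
        rw [← add_smul]
        congr 1
        ext <;> simp
      map_smul' := fun b u => Subtype.ext <| by
        change (⟨0, b • u, 0⟩ : TriMat A B U) • (m : M) =
          (⟨0, 0, b⟩ : TriMat A B U) • (⟨0, u, 0⟩ : TriMat A B U) • (m : M)
        rw [← mul_smul]
        congr 1
        ext <;> simp }
  map_add' m m' := LinearMap.ext fun u => Subtype.ext (smul_add _ (m : M) (m' : M))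
  map_smul' a m := LinearMap.ext fun u => Subtype.ext <| by
    change (⟨0, u, 0⟩ : TriMat A B U) • (⟨a, 0, 0⟩ : TriMat A B U) • (m : M) =
      (⟨0, op a • u, 0⟩ : TriMat A B U) • (m : M)
    rw [← mul_smul]
    congr 1
    ext <;> simp

/-- The map underlying the structure map `φ`, before passing to the quotient `U ⊗_A M₁` of
`U ⊗_ℤ M₁`. -/
def preStr : U ⊗[ℤ] fst A B U M →ₗ[B]
    snd A B U M :=
  TensorProduct.AlgebraTensorModule.lift
    { toFun := fun u =>
        { toFun := fun m => (show U →ₗ[B] snd A B U M from adj A B U M m) u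
          map_add' := fun m m' => Subtype.ext (smul_add _ (m : M) (m' : M))
          map_smul' := fun k m => by
            rw [map_zsmul]
            rfl }
      map_add' := fun u u' => LinearMap.ext fun m =>
        map_add (show U →ₗ[B] snd A B U M from adj A B U M m) u u'
      map_smul' := fun b u => LinearMap.ext fun m =>
        map_smul (show U →ₗ[B] snd A B U M from adj A B U M m) b u }

lemma balancedRel_le_ker_preStr :
    balancedRel A B U (fst A B U M) ≤ LinearMap.ker (preStr A B U M) := by
  refine Submodule.span_le.2 ?_
  rintro _ ⟨u, a, m, rfl⟩
  rw [SetLike.mem_coe, LinearMap.mem_ker, map_sub, sub_eq_zero]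
  refine Subtype.ext ?_
  change (⟨0, op a • u, 0⟩ : TriMat A B U) • (m : M) =
    (⟨0, u, 0⟩ : TriMat A B U) • (⟨a, 0, 0⟩ : TriMat A B U) • (m : M)
  rw [← mul_smul]
  congr 1
  ext <;> simp

/-- The structure map `φ : U ⊗_A M₁ → M₂`, `φ(u ⊗ m) = (0 0; u 0) m`. -/
def str : BimodTensor A B U (fst A B U M) →ₗ[B]
    snd A B U M :=
  Submodule.liftQ _ (preStr A B U M) (balancedRel_le_ker_preStr A B U M)

@[simp] lemma coe_adj_apply (m : fst A B U M) (u : U) :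
    (adj A B U M m u : M) = (⟨0, u, 0⟩ : TriMat A B U) • (m : M) := rfl

@[simp] lemma coe_str_mk_tmul (u : U) (m : fst A B U M) :
    (str A B U M (Submodule.Quotient.mk (u ⊗ₜ m)) : M) = (⟨0, u, 0⟩ : TriMat A B U) • (m : M) := rfl

variable {A B}

/-- The class `𝔄^P_Q` of modules `M` with `M₁ ∈ P` and `M₂ ∈ Q`. -/
def classA (P : ObjectProperty (ModuleCat.{u} A)) (Q : ObjectProperty (ModuleCat.{u} B)) :
    ObjectProperty (ModuleCat.{u} (TriMat A B U)) :=
  fun M => P (ModuleCat.of A (fst A B U M)) ∧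
    Q (ModuleCat.of B (snd A B U M))

/-- The class `𝔓^P_Q` of modules `M` with `M₁ ∈ P`, `Coker φ ∈ Q` and `φ` a monomorphism. -/
def classP (P : ObjectProperty (ModuleCat.{u} A)) (Q : ObjectProperty (ModuleCat.{u} B)) :
    ObjectProperty (ModuleCat.{u} (TriMat A B U)) :=
  fun M => P (ModuleCat.of A (fst A B U M)) ∧
    Q (ModuleCat.of B
      (snd A B U M ⧸ LinearMap.range (str A B U M))) ∧
    Function.Injective (str A B U M)

/-- The class `ℑ^P_Q` of modules `M` with `Ker φ~ ∈ P`, `M₂ ∈ Q` and `φ~` an epimorphism. -/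
def classI (P : ObjectProperty (ModuleCat.{u} A)) (Q : ObjectProperty (ModuleCat.{u} B)) :
    ObjectProperty (ModuleCat.{u} (TriMat A B U)) :=
  fun M => P (ModuleCat.of A (LinearMap.ker (adj A B U M))) ∧
    Q (ModuleCat.of B (snd A B U M)) ∧
    Function.Surjective (adj A B U M)

end TriMat

/-! The embeddings `X ↦ (X, 0)` and `Y ↦ (0, Y)` into `Λ`-modules are exact, and the components `M ↦
M₁` and `M ↦ M₂` are exact retractions of them. Both halves of each cotorsion pair are carried
across these functors.

Orthogonality: for `X ∈ C` and `Y ∈ E` the module `(X, U ⊗ X ⊕ Y)` lies in `𝔓`. Its projections to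
`(X, 0)` and `(0, Y)` split after passing to the first, respectively second, component. Hence
vanishing of its `Ext` into `(Z, 0)` or `(0, Z)` forces vanishing of `Ext` from `X` or `Y` into `Z`
(`subsingleton_ext_of_section`); no adjunction isomorphism on `Ext` is needed. For `ℑ` the module
`(Hom(U, Y) ⊕ X, Y)` plays the dual role (`subsingleton_ext_of_retraction`).

Approximations: take a component of the sequence attached to `(M, 0)` or `(0, M)`. For `(C, D)` in
the right case and `(E, F)` in the left case the component itself is the required sequence. In the
other right case, `0 → (0, M) → Y → X → 0` gives `0 → M → Y₂ → X₂ → 0` and `Y₁ ≅ X₁`, so `X₁ ∈ D`.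
Tor-vanishing keeps `U ⊗ -` exact on the first components of the coresolution of `X`, so `φ_X` is
mono and its cokernel has a coresolution by `E` (`hasCoresolution_coker`). Then `X₂` is an extension
of this cokernel by `U ⊗ X₁`, and closure under extensions applies. The left case is dual, with
`Hom(U, -)` and `Ker φ~` (`hasResolution_ker`).

Tor enters through the duality between `Tor_j(U, M)` and `Ext^j(M, Hom(U, W))` for injective `W`, of
which only the passage of vanishing from Tor to Ext is needed. Both exactness statements thus reduce
to dimension shifting for `Ext`. -/

/-! ### Ext along an exact functor with an exact retraction -/

section ExactRetract

universe w w' v v' u₁ u₂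

open Limits Abelian

variable {𝒞 : Type u₁} [Category.{v} 𝒞] [Abelian 𝒞] [HasExt.{w} 𝒞] [EnoughProjectives 𝒞]
  {𝒟 : Type u₂} [Category.{v'} 𝒟] [Abelian 𝒟] [HasExt.{w'} 𝒟]
  (F : 𝒞 ⥤ 𝒟) [F.Additive] [PreservesFiniteLimits F] [PreservesFiniteColimits F]
  (G : 𝒟 ⥤ 𝒞) [G.Additive] [PreservesFiniteLimits G] [PreservesFiniteColimits G]
  (τ : F ⋙ G ≅ 𝟭 𝒞)

/-- Associativity pastes the two commuting squares. Serves to separate the degree bookkeeping from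
the induction on the degree of an Ext class. -/
lemma ext_comp_square {X₁ X₁' X₃ X₃' Y Y' : 𝒞} {n m : ℕ} {c' : Ext X₃' X₁' 1} {c : Ext X₃ X₁ 1}
    {t₁ : X₁' ⟶ X₁} {t₃ : X₃' ⟶ X₃} {t : Y' ⟶ Y} {e' : Ext X₁' Y' n} {e : Ext X₁ Y n}
    (hm : 1 + n = m)
    (hc : c'.comp (Ext.mk₀ t₁) (add_zero 1) = (Ext.mk₀ t₃).comp c (zero_add 1))
    (he : e'.comp (Ext.mk₀ t) (add_zero n) = (Ext.mk₀ t₁).comp e (zero_add n)) :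
    (c'.comp e' hm).comp (Ext.mk₀ t) (add_zero m) =
      (Ext.mk₀ t₃).comp (c.comp e hm) (zero_add m) := by
  rw [Ext.comp_assoc (a₂₃ := n) _ _ _ (by omega) (by omega) (by omega), he,
    ← Ext.comp_assoc (a₁₂ := 1) _ _ _ (by omega) (by omega) (by omega), hc,
    Ext.comp_assoc (a₂₃ := m) _ _ _ (by omega) (by omega) (by omega)]

/-- If an exact functor `F` has an exact retraction `G`, then the action of `F` and then `G` on
`Ext` is conjugation by the isomorphism `F ⋙ G ≅ 𝟭`. -/
lemma mapExactFunctor_retract_naturality {X Y : 𝒞} {n : ℕ} (e : Ext X Y n) :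
    ((e.mapExactFunctor F).mapExactFunctor G).comp (Ext.mk₀ (τ.hom.app Y)) (add_zero n) =
      (Ext.mk₀ (τ.hom.app X)).comp e (zero_add n) := by
  induction n generalizing X with
  | zero =>
    obtain ⟨f, rfl⟩ := (Ext.mk₀_bijective X Y).2 e
    rw [Ext.mapExactFunctor_mk₀, Ext.mapExactFunctor_mk₀, Ext.mk₀_comp_mk₀, Ext.mk₀_comp_mk₀]
    exact congrArg Ext.mk₀ (τ.hom.naturality f)
  | succ n ih =>
    -- Dimension shifting: since `Ext` out of a projective vanishes in positive degree, `e` is the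
    -- class of `0 → ker → P → X → 0` times some `e'` of degree `n`.
    let P : ProjectivePresentation X := Classical.arbitrary _
    let S := ShortComplex.mk _ _ (kernel.condition P.f)
    have hS : S.ShortExact := { exact := ShortComplex.exact_kernel P.f }
    have hP : Projective S.X₂ := P.projective
    have : Subsingleton (Ext S.X₂ Y (n + 1)) := Ext.subsingleton_of_projective _ _ _
    obtain ⟨e', rfl⟩ := Ext.contravariant_sequence_exact₃ hS Y e (Subsingleton.elim _ _)
      (add_comm 1 n)
    have h₁ := (hS.map_of_exact F).map_of_exact G
    let φ : (S.map F).map G ⟶ S :=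
      { τ₁ := τ.hom.app S.X₁
        τ₂ := τ.hom.app S.X₂
        τ₃ := τ.hom.app S.X₃
        comm₁₂ := (τ.hom.naturality S.f).symm
        comm₂₃ := (τ.hom.naturality S.g).symm }
    have key : h₁.extClass.comp (Ext.mk₀ (τ.hom.app S.X₁)) (add_zero 1) =
        (Ext.mk₀ (τ.hom.app S.X₃)).comp hS.extClass (zero_add 1) :=
      ShortComplex.ShortExact.extClass_naturality h₁ hS φ
    have hmap : ((hS.extClass.comp e' (add_comm 1 n)).mapExactFunctor F).mapExactFunctor G =
        h₁.extClass.comp ((e'.mapExactFunctor F).mapExactFunctor G) (add_comm 1 n) := by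
      rw [Ext.mapExactFunctor_comp, Ext.mapExactFunctor_comp, Ext.mapExactFunctor_extClass]
      congr 1
      exact Ext.mapExactFunctor_extClass G (hS.map_of_exact F)
    exact (congrArg (fun z => Ext.comp z (Ext.mk₀ (τ.hom.app Y)) (add_zero (n + 1))) hmap).trans
      (ext_comp_square (add_comm 1 n) key (ih e'))

include τ

/-- For `e` in `Ext X Y n`, the pullback of `F(e)` along `π` is zero. Applying `G` and pulling back
along `s` shows that `GF(e)` vanishes on `τ.inv`, and by naturality of `τ` this says `e = 0`. -/
lemma subsingleton_ext_of_section {X Y : 𝒞} {N : 𝒟} {n : ℕ} (π : N ⟶ F.obj X)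
    (s : X ⟶ G.obj N) (hs : s ≫ G.map π = τ.inv.app X) [Subsingleton (Ext N (F.obj Y) n)] :
    Subsingleton (Ext X Y n) := by
  refine subsingleton_of_forall_eq 0 fun e => ?_
  have h₁ : (Ext.mk₀ π).comp (e.mapExactFunctor F) (zero_add n) = 0 := Subsingleton.elim _ _
  have h₂ := congrArg (Ext.mapExactFunctor G) h₁
  rw [Ext.mapExactFunctor_comp, Ext.mapExactFunctor_zero, Ext.mapExactFunctor_mk₀] at h₂
  have h₃ : (Ext.mk₀ (τ.inv.app X)).comp ((e.mapExactFunctor F).mapExactFunctor G)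
      (zero_add n) = 0 := by
    rw [← hs, ← Ext.mk₀_comp_mk₀_assoc, h₂, Ext.comp_zero]
  have h₄ := congrArg (fun z => (Ext.mk₀ (τ.inv.app X)).comp z (zero_add n))
    (mapExactFunctor_retract_naturality F G τ e)
  rw [← Ext.comp_assoc _ _ _ (zero_add n) (add_zero n) (by omega)] at h₄
  replace h₄ := (congrArg (fun z => Ext.comp z (Ext.mk₀ (τ.hom.app Y)) (add_zero n))
    h₃).symm.trans h₄
  rw [Ext.zero_comp, Ext.mk₀_comp_mk₀_assoc] at h₄
  simpa using h₄.symm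

/-- Dual argument: push `F(e)` forward along `j`, apply `G`, and undo the pushforward with `r`. -/
lemma subsingleton_ext_of_retraction {X Y : 𝒞} {N : 𝒟} {n : ℕ} (j : F.obj Y ⟶ N)
    (r : G.obj N ⟶ Y) (hr : G.map j ≫ r = τ.hom.app Y) [Subsingleton (Ext (F.obj X) N n)] :
    Subsingleton (Ext X Y n) := by
  refine subsingleton_of_forall_eq 0 fun e => ?_
  have h₁ : (e.mapExactFunctor F).comp (Ext.mk₀ j) (add_zero n) = 0 := Subsingleton.elim _ _
  have h₂ := congrArg (Ext.mapExactFunctor G) h₁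
  rw [Ext.mapExactFunctor_comp, Ext.mapExactFunctor_zero, Ext.mapExactFunctor_mk₀] at h₂
  have h₃ : ((e.mapExactFunctor F).mapExactFunctor G).comp (Ext.mk₀ (τ.hom.app Y))
      (add_zero n) = 0 := by
    rw [← hr, ← Ext.mk₀_comp_mk₀, ← Ext.comp_assoc _ _ _ (add_zero n) (add_zero 0) (by omega), h₂,
      Ext.zero_comp]
  have h₄ := congrArg (fun z => (Ext.mk₀ (τ.inv.app X)).comp z (zero_add n))
    (h₃.symm.trans (mapExactFunctor_retract_naturality F G τ e))
  simp only [Ext.comp_zero] at h₄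
  refine Eq.trans ?_ h₄.symm
  refine Eq.trans ?_ (Ext.mk₀_comp_mk₀_assoc _ _ _).symm
  simp

end ExactRetract

/-! ### Ext of modules: extension, lifting and dimension shifting -/

section ModuleExt

variable {R : Type u} [Ring R]

open Abelian

lemma subsingleton_ext_left {X : ModuleCat.{u} R} [Subsingleton X] (Y : ModuleCat.{u} R) (n : ℕ) :
    Subsingleton (Ext X Y n) := by
  refine subsingleton_of_forall_eq 0 fun e => ?_
  have h : 𝟙 X = 0 := (ModuleCat.isZero_of_subsingleton X).eq_of_src _ _
  rw [← Ext.mk₀_id_comp e, h, Ext.mk₀_zero, Ext.zero_comp]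

lemma subsingleton_ext_right (X : ModuleCat.{u} R) {Y : ModuleCat.{u} R} [Subsingleton Y] (n : ℕ) :
    Subsingleton (Ext X Y n) := by
  refine subsingleton_of_forall_eq 0 fun e => ?_
  have h : 𝟙 Y = 0 := (ModuleCat.isZero_of_subsingleton Y).eq_of_src _ _
  rw [← Ext.comp_mk₀_id e, h, Ext.mk₀_zero, Ext.comp_zero]

/-- A linear map on a submodule extends along the inclusion if `Ext¹` of the quotient vanishes. -/
lemma exists_extend_of_ext_one {S : ShortComplex (ModuleCat.{u} R)} (hS : S.ShortExact)
    (V : ModuleCat.{u} R) [Subsingleton (Ext S.X₃ V 1)] (h : S.X₁ ⟶ V) :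
    ∃ k : S.X₂ ⟶ V, S.f ≫ k = h := by
  obtain ⟨x, hx⟩ := Ext.contravariant_sequence_exact₁ hS V (Ext.mk₀ h) (add_zero 1)
    (Subsingleton.elim _ _)
  obtain ⟨k, rfl⟩ := (Ext.mk₀_bijective _ _).2 x
  rw [Ext.mk₀_comp_mk₀] at hx
  exact ⟨k, (Ext.mk₀_bijective _ _).1 hx⟩

/-- A linear map into a quotient lifts if `Ext¹` into the kernel vanishes. -/
lemma exists_lift_of_ext_one {S : ShortComplex (ModuleCat.{u} R)} (hS : S.ShortExact)
    (V : ModuleCat.{u} R) [Subsingleton (Ext V S.X₁ 1)] (h : V ⟶ S.X₃) :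
    ∃ k : V ⟶ S.X₂, k ≫ S.g = h := by
  obtain ⟨x, hx⟩ := Ext.covariant_sequence_exact₃ V hS (Ext.mk₀ h) (zero_add 1)
    (Subsingleton.elim _ _)
  obtain ⟨k, rfl⟩ := (Ext.mk₀_bijective _ _).2 x
  rw [Ext.mk₀_comp_mk₀] at hx
  exact ⟨k, (Ext.mk₀_bijective _ _).1 hx⟩

/-- Dimension shifting along an exact sequence `0 → S 1 → S 2 → ⋯ → S (m + 2) → 0`. -/
lemma subsingleton_ext_quotient_range (S : ℕ → ModuleCat.{u} R) (D : ∀ i, S i ⟶ S (i + 1))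
    (ex : ∀ i, Function.Exact (D i) (D (i + 1))) (V : ModuleCat.{u} R) (N m : ℕ)
    (hS : ∀ i, i ≤ m → ∀ j, 1 ≤ j → j ≤ N → Subsingleton (Ext (S (i + 2)) V j))
    (h0 : ∀ i, m < i → Subsingleton (S (i + 2))) (s i j : ℕ) (hi : m + 1 ≤ i + s) (hj : 1 ≤ j)
    (hjs : j + s ≤ N + 1) :
    Subsingleton (Ext (ModuleCat.of R (S (i + 1) ⧸ LinearMap.range (D i).hom)) V j) := by
  let f (i : ℕ) : (S (i + 1) ⧸ LinearMap.range (D i).hom) →ₗ[R] S (i + 2) :=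
    Submodule.liftQ _ (D (i + 1)).hom (by
      rintro _ ⟨x, rfl⟩
      exact (ex i).apply_apply_eq_zero x)
  have hf (i : ℕ) : Function.Injective (f i) := by
    rw [← LinearMap.ker_eq_bot]
    refine Submodule.ker_liftQ_eq_bot _ _ _ fun x hx => ?_
    exact (ex i x).1 hx
  -- Past `m` the quotient embeds in a zero module. Otherwise `0 → coker D i → S (i + 2) → coker D
  -- (i + 1) → 0` trades `Ext^j` for `Ext^(j+1)`; `s` bounds the number of trades left, and `j + s ≤
  -- N + 1` keeps every degree used on the `S (i + 2)` at most `N`.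
  by_cases him : m < i
  · have := h0 i him
    have : Subsingleton (S (i + 1) ⧸ LinearMap.range (D i).hom) := (hf i).subsingleton
    exact subsingleton_ext_left (X := ModuleCat.of R _) _ _
  · induction s generalizing i j with
    | zero => omega
    | succ s ih =>
      let T : ShortComplex (ModuleCat.{u} R) :=
        ShortComplex.mk (ModuleCat.ofHom (f i))
          (ModuleCat.ofHom (LinearMap.range (D (i + 1)).hom).mkQ) (by
            ext x
            exact (Submodule.Quotient.mk_eq_zero _).2 ⟨x, rfl⟩)
      have hT : T.ShortExact := by
        refine ModuleCat.shortComplex_shortExact _ ?_ (hf i) (Submodule.mkQ_surjective _)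
        intro x
        refine (Submodule.Quotient.mk_eq_zero _).trans ⟨?_, ?_⟩
        · rintro ⟨y, rfl⟩
          exact ⟨Submodule.Quotient.mk y, rfl⟩
        · rintro ⟨y, rfl⟩
          obtain ⟨y, rfl⟩ := Submodule.Quotient.mk_surjective _ y
          exact ⟨y, rfl⟩
      have h₂ : Subsingleton (Ext T.X₂ V j) := hS i (by omega) j hj (by omega)
      have h₃ : Subsingleton (Ext T.X₃ V (j + 1)) := by
        by_cases him' : m < i + 1
        · have := h0 (i + 1) him'
          have : Subsingleton (S (i + 1 + 1) ⧸ LinearMap.range (D (i + 1)).hom) :=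
            (hf (i + 1)).subsingleton
          exact subsingleton_ext_left (X := ModuleCat.of R _) _ _
        · exact ih (i + 1) (j + 1) (by omega) (by omega) (by omega) him'
      refine subsingleton_of_forall_eq 0 fun e => ?_
      obtain ⟨x, hx⟩ := Ext.contravariant_sequence_exact₁ hT V e (add_comm 1 j)
        (Subsingleton.elim _ _)
      refine hx.symm.trans ?_
      rw [Subsingleton.elim x 0, Ext.comp_zero]

/-- Dimension shifting along an exact sequence `0 → S (m + 2) → ⋯ → S 2 → S 1 → 0`. -/
lemma subsingleton_ext_ker (S : ℕ → ModuleCat.{u} R) (D : ∀ i, S (i + 1) ⟶ S i)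
    (ex : ∀ i, Function.Exact (D (i + 1)) (D i)) (V : ModuleCat.{u} R) (N m : ℕ)
    (hS : ∀ i, i ≤ m → ∀ j, 1 ≤ j → j ≤ N → Subsingleton (Ext V (S (i + 2)) j))
    (h0 : ∀ i, m < i → Subsingleton (S (i + 2))) (s i j : ℕ) (hi : m + 1 ≤ i + s) (hj : 1 ≤ j)
    (hjs : j + s ≤ N + 1) :
    Subsingleton (Ext V (ModuleCat.of R (LinearMap.ker (D i).hom)) j) := by
  let f (i : ℕ) : S (i + 2) →ₗ[R] LinearMap.ker (D i).hom :=
    LinearMap.codRestrict _ (D (i + 1)).hom fun x => (ex i).apply_apply_eq_zero x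
  have hf (i : ℕ) : Function.Surjective (f i) := by
    rintro ⟨y, hy⟩
    obtain ⟨x, rfl⟩ := (ex i y).1 hy
    exact ⟨x, rfl⟩
  -- The same count, with `0 → ker D (i + 1) → S (i + 2) → ker D i → 0`.
  by_cases him : m < i
  · have := h0 i him
    have : Subsingleton (LinearMap.ker (D i).hom) := (hf i).subsingleton
    exact subsingleton_ext_right _ (Y := ModuleCat.of R _) _
  · induction s generalizing i j with
    | zero => omega
    | succ s ih =>
      let T : ShortComplex (ModuleCat.{u} R) :=
        ShortComplex.mk (ModuleCat.ofHom (LinearMap.ker (D (i + 1)).hom).subtype)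
          (ModuleCat.ofHom (f i)) (by
            ext x
            exact x.2)
      have hT : T.ShortExact := by
        refine ModuleCat.shortComplex_shortExact _ ?_ Subtype.val_injective (hf i)
        intro x
        refine ⟨fun hx => ⟨⟨x, congrArg Subtype.val hx⟩, rfl⟩, ?_⟩
        rintro ⟨y, rfl⟩
        exact Subtype.ext y.2
      have h₂ : Subsingleton (Ext V T.X₂ j) := hS i (by omega) j hj (by omega)
      have h₁ : Subsingleton (Ext V T.X₁ (j + 1)) := by
        by_cases him' : m < i + 1
        · have := h0 (i + 1) him'
          have : Subsingleton (LinearMap.ker (D (i + 1)).hom) := (hf (i + 1)).subsingleton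
          exact subsingleton_ext_right _ (Y := ModuleCat.of R _) _
        · exact ih (i + 1) (j + 1) (by omega) (by omega) (by omega) him'
      refine subsingleton_of_forall_eq 0 fun e => ?_
      obtain ⟨x, hx⟩ := Ext.covariant_sequence_exact₃ V hT e rfl (Subsingleton.elim _ _)
      refine hx.symm.trans ?_
      rw [Subsingleton.elim x 0, Ext.zero_comp]

end ModuleExt

/-! ### The tensor-Hom adjunction for a bimodule, and Tor through Ext -/

section TensorHom

open Abelian

variable {A B U : Type u} [Ring A] [Ring B] [AddCommGroup U] [Module B U] [Module Aᵐᵒᵖ U]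
  [SMulCommClass B Aᵐᵒᵖ U]
  {X Y Z : Type u} [AddCommGroup X] [Module A X] [AddCommGroup Y] [Module A Y]
  [AddCommGroup Z] [Module A Z] {W V : Type u} [AddCommGroup W] [Module B W]
  [AddCommGroup V] [Module B V]

namespace BimodHom

/-- An element of `Hom_B(U, W)` as a linear map. -/
def toLin (f : BimodHom B U W) : U →ₗ[B] W := f

@[ext] lemma ext {f g : BimodHom B U W} (h : ∀ u, f u = g u) : f = g := LinearMap.ext h

@[simp] lemma add_apply (f g : BimodHom B U W) (u : U) : (f + g) u = f u + g u := rfl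

@[simp] lemma zero_apply (u : U) : (0 : BimodHom B U W) u = 0 := rfl

@[simp] lemma apply_add (f : BimodHom B U W) (u v : U) : f (u + v) = f u + f v :=
  f.toLin.map_add u v

@[simp] lemma apply_smul (f : BimodHom B U W) (b : B) (u : U) : f (b • u) = b • f u :=
  f.toLin.map_smul b u

@[simp] lemma apply_zero (f : BimodHom B U W) : f 0 = 0 := f.toLin.map_zero

variable (A U) in
/-- The map `Hom_B(U, g)`. -/
def map (g : W →ₗ[B] V) : BimodHom B U W →ₗ[A] BimodHom B U V where
  toFun f := g.comp f.toLin
  map_add' _ _ := LinearMap.ext fun _ => g.map_add _ _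
  map_smul' _ _ := rfl

end BimodHom

namespace BimodTensor

lemma mk_add_tmul (u v : U) (x : X) :
    (Submodule.Quotient.mk ((u + v) ⊗ₜ x) : BimodTensor A B U X) =
      Submodule.Quotient.mk (u ⊗ₜ x) + Submodule.Quotient.mk (v ⊗ₜ x) := by
  rw [TensorProduct.add_tmul]; rfl

lemma mk_tmul_add (u : U) (x y : X) :
    (Submodule.Quotient.mk (u ⊗ₜ (x + y)) : BimodTensor A B U X) =
      Submodule.Quotient.mk (u ⊗ₜ x) + Submodule.Quotient.mk (u ⊗ₜ y) := by
  rw [TensorProduct.tmul_add]; rfl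

lemma mk_smul_tmul (b : B) (u : U) (x : X) :
    (Submodule.Quotient.mk ((b • u) ⊗ₜ x) : BimodTensor A B U X) =
      b • Submodule.Quotient.mk (u ⊗ₜ x) := by
  rw [← TensorProduct.smul_tmul']; rfl

lemma mk_op_smul_tmul (a : A) (u : U) (x : X) :
    (Submodule.Quotient.mk ((op a • u) ⊗ₜ x) : BimodTensor A B U X) =
      Submodule.Quotient.mk (u ⊗ₜ (a • x)) :=
  (Submodule.Quotient.eq _).2 (Submodule.subset_span ⟨u, a, x, rfl⟩)

/-- The linear map `U ⊗_A X → W` adjoint to a linear map `X → Hom_B(U, W)`. -/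
def lift (f : X →ₗ[A] BimodHom B U W) : BimodTensor A B U X →ₗ[B] W :=
  Submodule.liftQ _
    (TensorProduct.AlgebraTensorModule.lift
      { toFun := fun u =>
          { toFun := fun x => f x u
            map_add' := fun x y => by rw [map_add, BimodHom.add_apply]
            map_smul' := fun k x => by
              have : f (k • x) = k • f x := map_zsmul f k x
              rw [this]
              rfl }
        map_add' := fun u v => LinearMap.ext fun x => (f x).apply_add u v
        map_smul' := fun b u => LinearMap.ext fun x => (f x).apply_smul b u })
    (by
      refine Submodule.span_le.2 ?_
      rintro _ ⟨u, a, x, rfl⟩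
      rw [SetLike.mem_coe, LinearMap.mem_ker, map_sub, sub_eq_zero]
      change f x (op a • u) = f (a • x) u
      exact congrArg (fun h : BimodHom B U W => h u) (f.map_smul a x).symm)

/-- The linear map `X → Hom_B(U, W)` adjoint to a linear map `U ⊗_A X → W`. -/
def curry (g : BimodTensor A B U X →ₗ[B] W) : X →ₗ[A] BimodHom B U W where
  toFun x := show U →ₗ[B] W from
    { toFun := fun u => g (Submodule.Quotient.mk (u ⊗ₜ x))
      map_add' := fun u v => by rw [mk_add_tmul, map_add]
      map_smul' := fun b u => by rw [mk_smul_tmul, map_smul]; rfl }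
  map_add' x y := LinearMap.ext fun u => by
    change g _ = g _ + g _
    rw [mk_tmul_add, map_add]
  map_smul' a x := LinearMap.ext fun u => by
    change g _ = g (Submodule.Quotient.mk ((op a • u) ⊗ₜ x))
    rw [mk_op_smul_tmul]

lemma lift_curry (g : BimodTensor A B U X →ₗ[B] W) : lift (curry g) = g := hom_ext fun _ _ => rfl

lemma lift_comp (f : Y →ₗ[A] BimodHom B U W) (h : X →ₗ[A] Y) :
    lift (f ∘ₗ h) = lift f ∘ₗ map A B U h := hom_ext fun _ _ => rfl

lemma map_comp (g : Y →ₗ[A] Z) (f : X →ₗ[A] Y) :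
    map A B U (g ∘ₗ f) = map A B U g ∘ₗ map A B U f := hom_ext fun _ _ => rfl

lemma subsingleton [Subsingleton X] : Subsingleton (BimodTensor A B U X) := by
  refine subsingleton_of_forall_eq 0 fun t => ?_
  have h : (LinearMap.id : BimodTensor A B U X →ₗ[B] _) = 0 := hom_ext fun u x => by
    rw [Subsingleton.elim x 0, TensorProduct.tmul_zero]
    rfl
  exact congrArg (fun f => f t) h

lemma map_bijective (e : X ≃ₗ[A] Y) : Function.Bijective (map A B U (e : X →ₗ[A] Y)) := by
  refine Function.bijective_iff_has_inverse.2 ⟨map A B U (e.symm : Y →ₗ[A] X), fun t => ?_,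
    fun t => ?_⟩
  · have h : map A B U (e.symm : Y →ₗ[A] X) ∘ₗ map A B U (e : X →ₗ[A] Y) = LinearMap.id := by
      refine hom_ext fun u x => ?_
      simp
    exact congrArg (fun f => f t) h
  · have h : map A B U (e : X →ₗ[A] Y) ∘ₗ map A B U (e.symm : Y →ₗ[A] X) = LinearMap.id := by
      refine hom_ext fun u x => ?_
      simp
    exact congrArg (fun f => f t) h

end BimodTensor

variable (A U) in
/-- The `A`-module `Hom_B(U, W)`. -/
abbrev bimodHomObj (W : ModuleCat.{u} B) : ModuleCat.{u} A := ModuleCat.of A (BimodHom B U W)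

/-- `U ⊗_A -` preserves exactness at `Y` of `X → Y → Z` as soon as `Ext¹_A(Z / im Y, -)` vanishes on
all `Hom_B(U, W)` with `W` injective. -/
lemma BimodTensor.exact_map {f : X →ₗ[A] Y} {g : Y →ₗ[A] Z} (h : Function.Exact f g)
    (hZ : ∀ W : ModuleCat.{u} B, Injective W →
      Subsingleton (Ext (ModuleCat.of A (Z ⧸ LinearMap.range g)) (bimodHomObj A U W) 1)) :
    Function.Exact (BimodTensor.map A B U f) (BimodTensor.map A B U g) := by
  intro t
  constructor
  · intro ht
    -- Membership in the image of `1 ⊗ f` is tested by the map `q` to the cokernel followed by an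
    -- embedding in an injective module.
    let Q := ModuleCat.of B (BimodTensor A B U Y ⧸ LinearMap.range (BimodTensor.map A B U f))
    let W := Injective.under Q
    let q : BimodTensor A B U Y →ₗ[B] W :=
      (Injective.ι Q).hom ∘ₗ (LinearMap.range (BimodTensor.map A B U f)).mkQ
    have hq : q ∘ₗ BimodTensor.map A B U f = 0 := by
      ext x
      change (Injective.ι Q).hom _ = 0
      rw [← (Injective.ι Q).hom.map_zero]
      congr 1
      exact (Submodule.Quotient.mk_eq_zero _).2 ⟨_, rfl⟩
    have hker : ∀ y, g y = 0 → BimodTensor.curry q y = 0 := by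
      intro y hy
      obtain ⟨x, rfl⟩ := (h y).1 hy
      ext u
      exact congrArg (fun k => k (Submodule.Quotient.mk (u ⊗ₜ x))) hq
    let T : ShortComplex (ModuleCat.{u} A) :=
      ShortComplex.mk (ModuleCat.ofHom (LinearMap.range g).subtype)
        (ModuleCat.ofHom (LinearMap.range g).mkQ) (by
          ext x
          exact (Submodule.Quotient.mk_eq_zero _).2 x.2)
    have hT : T.ShortExact := by
      refine ModuleCat.shortComplex_shortExact _ (fun x => ?_) Subtype.val_injective
        (Submodule.mkQ_surjective _)
      exact (Submodule.Quotient.mk_eq_zero _).trans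
        ⟨fun hx => ⟨⟨x, hx⟩, rfl⟩, fun ⟨y, hy⟩ => hy ▸ y.2⟩
    have : Subsingleton (Ext T.X₃ (bimodHomObj A U W) 1) := hZ W inferInstance
    let k : (Y ⧸ LinearMap.ker g) →ₗ[A] BimodHom B U W :=
      Submodule.liftQ _ (BimodTensor.curry q) fun y hy => hker y hy
    -- The adjoint of `q` kills `ker g = im f`, so it descends to `im g`; the `Ext¹` hypothesis
    -- extends it to `Z`. Hence `q` factors through `1 ⊗ g`.
    obtain ⟨l, hl⟩ := exists_extend_of_ext_one hT (bimodHomObj A U W)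
      (ModuleCat.ofHom (k ∘ₗ g.quotKerEquivRange.symm.toLinearMap))
    have hlg : l.hom ∘ₗ g = BimodTensor.curry q := by
      ext1 y
      have := congrArg (fun m => m.hom (⟨g y, y, rfl⟩ : LinearMap.range g)) hl
      refine this.trans ?_
      change k (g.quotKerEquivRange.symm ⟨g y, y, rfl⟩) = _
      have e : g.quotKerEquivRange.symm ⟨g y, y, rfl⟩ = Submodule.Quotient.mk y := by
        rw [LinearEquiv.symm_apply_eq]
        rfl
      rw [e]
      rfl
    have hqt : q t = 0 := by
      rw [← BimodTensor.lift_curry q, ← hlg, BimodTensor.lift_comp, LinearMap.comp_apply, ht,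
        map_zero]
    have hinj : Function.Injective (Injective.ι Q).hom :=
      (ModuleCat.mono_iff_injective _).1 inferInstance
    have : (LinearMap.range (BimodTensor.map A B U f)).mkQ t = 0 := by
      apply hinj
      rw [map_zero]
      exact hqt
    exact (Submodule.Quotient.mk_eq_zero _).1 this
  · rintro ⟨s, rfl⟩
    have : BimodTensor.map A B U g ∘ₗ BimodTensor.map A B U f = 0 := by
      rw [← BimodTensor.map_comp, h.linearMap_comp_eq_zero]
      refine BimodTensor.hom_ext fun u x => ?_
      rw [BimodTensor.map_mk_tmul, LinearMap.zero_apply, TensorProduct.tmul_zero]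
      rfl
    exact congrArg (fun m => m s) this

/-- `Tor`-vanishing as `Ext`-vanishing against the modules `Hom_B(U, W)` with `W` injective. -/
lemma subsingleton_ext_of_isZero_bimodTor {M : ModuleCat.{u} A} {p : ℕ}
    (h : Limits.IsZero (bimodTor A B U (p + 1) M)) (W : ModuleCat.{u} B) (hW : Injective W) :
    Subsingleton (Ext M (bimodHomObj A U W) (p + 1)) := by
  let P : ProjectiveResolution M := ProjectiveResolution.of M
  let K := ((bimodTensorFunctor A B U).mapHomologicalComplex _).obj P.complex
  have hK : K.ExactAt (p + 1) := by
    rw [HomologicalComplex.exactAt_iff_isZero_homology]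
    exact h.of_iso (P.isoLeftDerivedObj (bimodTensorFunctor A B U) (p + 1)).symm
  have hK' : (ShortComplex.mk _ _ (K.d_comp_d (p + 2) (p + 1) p)).Exact :=
    (HomologicalComplex.exactAt_iff' _ (p + 2) (p + 1) p (by simp) (by simp)).1 hK
  refine subsingleton_of_forall_eq 0 fun e => ?_
  -- The class is represented by a cocycle on a projective resolution; it remains to write it as a
  -- coboundary.
  obtain ⟨f, hf, rfl⟩ := P.extMk_surjective e (p + 2) rfl
  rw [P.extMk_eq_zero_iff f _ rfl hf p rfl]
  let φ : K.X (p + 1) ⟶ W := ModuleCat.ofHom (BimodTensor.lift f.hom)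
  have hφ : K.d (p + 2) (p + 1) ≫ φ = 0 := by
    refine ModuleCat.hom_ext (BimodTensor.hom_ext fun u x => ?_)
    exact congrArg (fun m : P.complex.X (p + 2) ⟶ bimodHomObj A U W => (m x : BimodHom B U W) u) hf
  -- The adjoint of the cocycle kills the boundaries of `U ⊗ P`. By exactness in degree `p + 1` and
  -- injectivity of `W` it extends along the differential, and the adjoint of this extension is the
  -- bounding cochain.
  refine ⟨ModuleCat.ofHom (BimodTensor.curry (hK'.descToInjective φ hφ).hom), ?_⟩
  ext x u
  exact congrArg (fun m => m (Submodule.Quotient.mk (u ⊗ₜ x))) (hK'.comp_descToInjective φ hφ)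

end TensorHom

/-! ### Exactness of restriction of scalars -/

section RestrictScalars

open Limits

variable {R S : Type u} [Ring R] [Ring S] (f : R →+* S)

lemma preservesFinite_of_map_exact (F : ModuleCat.{u} R ⥤ ModuleCat.{u} S) [F.Additive]
    (h : ∀ T : ShortComplex (ModuleCat.{u} R), T.Exact → (T.map F).Exact) :
    PreservesFiniteLimits F ∧ PreservesFiniteColimits F :=
  ((Functor.exact_tfae F).out 1 3).mp h

lemma restrictScalars_map_exact (T : ShortComplex (ModuleCat.{u} S)) (h : T.Exact) :
    (T.map (ModuleCat.restrictScalars.{u} f)).Exact := by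
  rw [ShortComplex.ShortExact.moduleCat_exact_iff_function_exact] at h ⊢
  exact h

instance : PreservesFiniteLimits (ModuleCat.restrictScalars.{u} f) :=
  (preservesFinite_of_map_exact _ (restrictScalars_map_exact f)).1

instance : PreservesFiniteColimits (ModuleCat.restrictScalars.{u} f) :=
  (preservesFinite_of_map_exact _ (restrictScalars_map_exact f)).2

end RestrictScalars

/-! ### Components of modules over the triangular ring and the two embeddings -/

namespace TriMat

open Limits

variable {A B U : Type u} [Ring A] [Ring B] [AddCommGroup U] [Module B U] [Module Aᵐᵒᵖ U]
  [SMulCommClass B Aᵐᵒᵖ U]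
  {M N P : Type u} [AddCommGroup M] [Module (TriMat A B U) M]
  [AddCommGroup N] [Module (TriMat A B U) N] [AddCommGroup P] [Module (TriMat A B U) P]

/-- The restriction `M₁ → N₁` of a linear map `M → N`. -/
def fstMap (f : M →ₗ[TriMat A B U] N) : fst A B U M →ₗ[A] fst A B U N where
  toFun m := ⟨f m, by rw [mem_fst, ← map_smul, m.2]⟩
  map_add' _ _ := Subtype.ext (f.map_add _ _)
  map_smul' _ _ := Subtype.ext (f.map_smul _ _)

/-- The restriction `M₂ → N₂` of a linear map `M → N`. -/
def sndMap (f : M →ₗ[TriMat A B U] N) : snd A B U M →ₗ[B] snd A B U N where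
  toFun m := ⟨f m, by rw [mem_snd, ← map_smul, m.2]⟩
  map_add' _ _ := Subtype.ext (f.map_add _ _)
  map_smul' _ _ := Subtype.ext (f.map_smul _ _)

@[simp] lemma coe_fstMap (f : M →ₗ[TriMat A B U] N) (m : fst A B U M) :
    (fstMap f m : N) = f m := rfl

@[simp] lemma coe_sndMap (f : M →ₗ[TriMat A B U] N) (m : snd A B U M) :
    (sndMap f m : N) = f m := rfl

variable (A B U) in
lemma e₁_smul_mem (m : M) : (⟨1, 0, 0⟩ : TriMat A B U) • m ∈ fst A B U M := by
  rw [mem_fst, ← mul_smul]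
  congr 1
  ext <;> simp

variable (A B U) in
lemma e₂_smul_mem (m : M) : (⟨0, 0, 1⟩ : TriMat A B U) • m ∈ snd A B U M := by
  rw [mem_snd, ← mul_smul]
  congr 1
  ext <;> simp

lemma fstMap_exact {f : M →ₗ[TriMat A B U] N} {g : N →ₗ[TriMat A B U] P}
    (h : Function.Exact f g) : Function.Exact (fstMap f) (fstMap g) := by
  intro y
  constructor
  · intro hy
    obtain ⟨x, hx⟩ := (h y).1 (congrArg Subtype.val hy)
    -- An arbitrary preimage is moved into the first component by the idempotent `e₁`, which fixes
    -- `y`.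
    refine ⟨⟨_, e₁_smul_mem A B U x⟩, Subtype.ext ?_⟩
    rw [coe_fstMap, map_smul, hx, y.2]
  · rintro ⟨x, rfl⟩
    exact Subtype.ext (h.apply_apply_eq_zero _)

lemma sndMap_exact {f : M →ₗ[TriMat A B U] N} {g : N →ₗ[TriMat A B U] P}
    (h : Function.Exact f g) : Function.Exact (sndMap f) (sndMap g) := by
  intro y
  constructor
  · intro hy
    obtain ⟨x, hx⟩ := (h y).1 (congrArg Subtype.val hy)
    refine ⟨⟨_, e₂_smul_mem A B U x⟩, Subtype.ext ?_⟩
    rw [coe_sndMap, map_smul, hx, y.2]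
  · rintro ⟨x, rfl⟩
    exact Subtype.ext (h.apply_apply_eq_zero _)

lemma fstMap_injective {f : M →ₗ[TriMat A B U] N} (h : Function.Injective f) :
    Function.Injective (fstMap f) :=
  fun _ _ hxy => Subtype.ext (h (congrArg Subtype.val hxy))

lemma sndMap_injective {f : M →ₗ[TriMat A B U] N} (h : Function.Injective f) :
    Function.Injective (sndMap f) :=
  fun _ _ hxy => Subtype.ext (h (congrArg Subtype.val hxy))

lemma fstMap_surjective {f : M →ₗ[TriMat A B U] N} (h : Function.Surjective f) :
    Function.Surjective (fstMap f) := by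
  intro y
  obtain ⟨x, hx⟩ := h y
  refine ⟨⟨_, e₁_smul_mem A B U x⟩, Subtype.ext ?_⟩
  rw [coe_fstMap, map_smul, hx, y.2]

lemma sndMap_surjective {f : M →ₗ[TriMat A B U] N} (h : Function.Surjective f) :
    Function.Surjective (sndMap f) := by
  intro y
  obtain ⟨x, hx⟩ := h y
  refine ⟨⟨_, e₂_smul_mem A B U x⟩, Subtype.ext ?_⟩
  rw [coe_sndMap, map_smul, hx, y.2]

/-- On a pure tensor this is linearity of `f` with respect to the matrix with only entry `u`. -/
lemma str_naturality (f : M →ₗ[TriMat A B U] N) :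
    sndMap f ∘ₗ str A B U M = str A B U N ∘ₗ BimodTensor.map A B U (fstMap f) :=
  BimodTensor.hom_ext fun _ _ => Subtype.ext (f.map_smul _ _)

lemma str_naturality_apply (f : M →ₗ[TriMat A B U] N) (t : BimodTensor A B U (fst A B U M)) :
    sndMap f (str A B U M t) = str A B U N (BimodTensor.map A B U (fstMap f) t) :=
  congrArg (fun g => g t) (str_naturality f)

lemma adj_naturality_apply (f : M →ₗ[TriMat A B U] N) (m : fst A B U M) :
    BimodHom.map A U (sndMap f) (adj A B U M m) = adj A B U N (fstMap f m) :=
  BimodHom.ext fun _ => Subtype.ext (f.map_smul _ _)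

variable (A B U)

/-- The functor `M ↦ M₁`. -/
def fstFunctor : ModuleCat.{u} (TriMat A B U) ⥤ ModuleCat.{u} A where
  obj M := ModuleCat.of A (fst A B U M)
  map f := ModuleCat.ofHom (fstMap f.hom)

/-- The functor `M ↦ M₂`. -/
def sndFunctor : ModuleCat.{u} (TriMat A B U) ⥤ ModuleCat.{u} B where
  obj M := ModuleCat.of B (snd A B U M)
  map f := ModuleCat.ofHom (sndMap f.hom)

instance : (fstFunctor A B U).Additive where
  map_add := rfl

instance : (sndFunctor A B U).Additive where
  map_add := rfl

lemma fstFunctor_map_exact (T : ShortComplex (ModuleCat.{u} (TriMat A B U))) (h : T.Exact) :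
    (T.map (fstFunctor A B U)).Exact := by
  rw [ShortComplex.ShortExact.moduleCat_exact_iff_function_exact] at h ⊢
  exact fstMap_exact h

lemma sndFunctor_map_exact (T : ShortComplex (ModuleCat.{u} (TriMat A B U))) (h : T.Exact) :
    (T.map (sndFunctor A B U)).Exact := by
  rw [ShortComplex.ShortExact.moduleCat_exact_iff_function_exact] at h ⊢
  exact sndMap_exact h

instance : PreservesFiniteLimits (fstFunctor A B U) :=
  (preservesFinite_of_map_exact _ (fstFunctor_map_exact A B U)).1

instance : PreservesFiniteColimits (fstFunctor A B U) :=
  (preservesFinite_of_map_exact _ (fstFunctor_map_exact A B U)).2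

instance : PreservesFiniteLimits (sndFunctor A B U) :=
  (preservesFinite_of_map_exact _ (sndFunctor_map_exact A B U)).1

instance : PreservesFiniteColimits (sndFunctor A B U) :=
  (preservesFinite_of_map_exact _ (sndFunctor_map_exact A B U)).2

/-- The projection to the upper left corner. -/
def projA : TriMat A B U →+* A where
  toFun := TriMat.a
  map_one' := rfl
  map_mul' _ _ := rfl
  map_zero' := rfl
  map_add' _ _ := rfl

/-- The projection to the lower right corner. -/
def projB : TriMat A B U →+* B where
  toFun := TriMat.b
  map_one' := rfl
  map_mul' _ _ := rfl
  map_zero' := rfl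
  map_add' _ _ := rfl

/-- The functor `X ↦ (X, 0)`. -/
noncomputable abbrev inclA : ModuleCat.{u} A ⥤ ModuleCat.{u} (TriMat A B U) :=
  ModuleCat.restrictScalars (projA A B U)

/-- The functor `Y ↦ (0, Y)`. -/
noncomputable abbrev inclB : ModuleCat.{u} B ⥤ ModuleCat.{u} (TriMat A B U) :=
  ModuleCat.restrictScalars (projB A B U)

variable {A B}

/-- `(X, 0)₁ ≃ X`. -/
def fstInclA (X : ModuleCat.{u} A) : fst A B U ((inclA A B U).obj X) ≃ₗ[A] X where
  toFun x := show X from x.1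
  map_add' _ _ := rfl
  map_smul' _ _ := rfl
  invFun x := ⟨x, one_smul A (show X from x)⟩
  left_inv _ := rfl
  right_inv _ := rfl

/-- `(0, Y)₂ ≃ Y`. -/
def sndInclB (Y : ModuleCat.{u} B) : snd A B U ((inclB A B U).obj Y) ≃ₗ[B] Y where
  toFun y := show Y from y.1
  map_add' _ _ := rfl
  map_smul' _ _ := rfl
  invFun y := ⟨y, one_smul B (show Y from y)⟩
  left_inv _ := rfl
  right_inv _ := rfl

instance (X : ModuleCat.{u} A) : Subsingleton (snd A B U ((inclA A B U).obj X)) :=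
  subsingleton_of_forall_eq 0 fun x =>
    Subtype.ext (x.2.symm.trans (zero_smul A (show X from x.1)))

instance (Y : ModuleCat.{u} B) : Subsingleton (fst A B U ((inclB A B U).obj Y)) :=
  subsingleton_of_forall_eq 0 fun y =>
    Subtype.ext (y.2.symm.trans (zero_smul B (show Y from y.1)))

variable (A B)

/-- `X ↦ (X, 0)₁` is isomorphic to the identity. -/
noncomputable def inclACompFst : inclA A B U ⋙ fstFunctor A B U ≅ 𝟭 _ :=
  NatIso.ofComponents (fun X => (fstInclA U X).toModuleIso) fun _ => rfl

/-- `Y ↦ (0, Y)₂` is isomorphic to the identity. -/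
noncomputable def inclBCompSnd : inclB A B U ⋙ sndFunctor A B U ≅ 𝟭 _ :=
  NatIso.ofComponents (fun Y => (sndInclB U Y).toModuleIso) fun _ => rfl

/-! ### Modules built from triples -/

section Triple

variable {A B U} {X Y : Type u} [AddCommGroup X] [Module A X] [AddCommGroup Y] [Module B Y]

/-- The module over the triangular matrix ring given by a triple `(X, Y, β)`. -/
@[nolint unusedArguments]
def Triple (_ : X →ₗ[A] BimodHom B U Y) : Type u := X × Y

variable (β : X →ₗ[A] BimodHom B U Y)

instance : AddCommGroup (Triple β) := inferInstanceAs (AddCommGroup (X × Y))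

instance : Module (TriMat A B U) (Triple β) where
  smul r m := (r.a • m.1, β m.1 r.u + r.b • m.2)
  one_smul m := Prod.ext (one_smul A m.1) (by
    change β m.1 0 + (1 : B) • m.2 = m.2
    simp)
  mul_smul r s m := Prod.ext (mul_smul r.a s.a m.1) (by
    change β m.1 (op s.a • r.u + r.b • s.u) + (r.b * s.b) • m.2 =
      β (s.a • m.1) r.u + r.b • (β m.1 s.u + s.b • m.2)
    simp [mul_smul, add_assoc])
  smul_zero r := Prod.ext (smul_zero r.a) (by
    change β 0 r.u + r.b • (0 : Y) = 0
    simp)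
  smul_add r m n := Prod.ext (smul_add r.a m.1 n.1) (by
    change β (m.1 + n.1) r.u + r.b • (m.2 + n.2) = (β m.1 r.u + r.b • m.2) + (β n.1 r.u + r.b • n.2)
    rw [map_add, BimodHom.add_apply, smul_add]
    abel)
  add_smul r s m := Prod.ext (add_smul r.a s.a m.1) (by
    change β m.1 (r.u + s.u) + (r.b + s.b) • m.2 = (β m.1 r.u + r.b • m.2) + (β m.1 s.u + s.b • m.2)
    rw [BimodHom.apply_add, add_smul]
    abel)
  zero_smul m := Prod.ext (zero_smul A m.1) (by
    change β m.1 0 + (0 : B) • m.2 = 0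
    simp)

namespace Triple

/-- The first component of a triple. -/
def fstEquiv : fst A B U (Triple β) ≃ₗ[A] X where
  toFun m := m.1.1
  map_add' _ _ := rfl
  map_smul' _ _ := rfl
  invFun x := ⟨((x, 0) : X × Y), Prod.ext (one_smul A x) (by
    change β x 0 + (0 : B) • (0 : Y) = 0
    simp)⟩
  left_inv m := Subtype.ext (Prod.ext rfl (by
    have h : β m.1.1 0 + (0 : B) • m.1.2 = m.1.2 := congrArg Prod.snd m.2
    simpa using h))
  right_inv _ := rfl

/-- The second component of a triple. -/
def sndEquiv : snd A B U (Triple β) ≃ₗ[B] Y where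
  toFun m := m.1.2
  map_add' _ _ := rfl
  map_smul' b m := by
    change β m.1.1 0 + b • m.1.2 = b • m.1.2
    simp
  invFun y := ⟨((0, y) : X × Y), Prod.ext (zero_smul A (0 : X)) (by
    change β 0 0 + (1 : B) • y = y
    simp)⟩
  left_inv m := Subtype.ext (Prod.ext (by
    have h : (0 : A) • m.1.1 = m.1.1 := congrArg Prod.fst m.2
    simpa using h) rfl)
  right_inv _ := rfl

lemma sndEquiv_adj (m : fst A B U (Triple β)) (u : U) :
    sndEquiv β (adj A B U (Triple β) m u) = β (fstEquiv β m) u := by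
  change β m.1.1 u + (0 : B) • m.1.2 = β m.1.1 u
  simp

lemma sndEquiv_str (t : BimodTensor A B U (fst A B U (Triple β))) :
    sndEquiv β (str A B U (Triple β) t) =
      BimodTensor.lift β (BimodTensor.map A B U (fstEquiv β).toLinearMap t) := by
  have h : (sndEquiv β).toLinearMap ∘ₗ str A B U (Triple β) =
      BimodTensor.lift β ∘ₗ BimodTensor.map A B U (fstEquiv β).toLinearMap :=
    BimodTensor.hom_ext fun u m => sndEquiv_adj β m u
  exact congrArg (fun f => f t) h

/-- Under `fstEquiv` and `sndEquiv` the structure map becomes `lift β` (`sndEquiv_str`), so its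
kernel and cokernel can be read off from `lift β`. -/
lemma classP_of (P : ObjectProperty (ModuleCat.{u} A)) (Q : ObjectProperty (ModuleCat.{u} B))
    [P.IsClosedUnderIsomorphisms] [Q.IsClosedUnderIsomorphisms]
    (hP : P (ModuleCat.of A X))
    (hQ : Q (ModuleCat.of B (Y ⧸ LinearMap.range (BimodTensor.lift β))))
    (hβ : Function.Injective (BimodTensor.lift β)) :
    classP U P Q (ModuleCat.of (TriMat A B U) (Triple β)) := by
  have hb := BimodTensor.map_bijective (B := B) (U := U) (fstEquiv β)
  refine ⟨P.prop_of_iso (fstEquiv β).symm.toModuleIso hP, ?_, ?_⟩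
  · refine Q.prop_of_iso (LinearEquiv.toModuleIso ?_) hQ
    refine (Submodule.Quotient.equiv _ _ (sndEquiv β) ?_).symm
    ext y
    constructor
    · rintro ⟨_, ⟨t, rfl⟩, rfl⟩
      exact ⟨_, (sndEquiv_str β t).symm⟩
    · rintro ⟨t, rfl⟩
      obtain ⟨t, rfl⟩ := hb.2 t
      exact ⟨_, ⟨t, rfl⟩, sndEquiv_str β t⟩
  · intro s t hst
    apply hb.1
    apply hβ
    have := congrArg (sndEquiv β) hst
    rwa [sndEquiv_str, sndEquiv_str] at this

lemma classI_of (P : ObjectProperty (ModuleCat.{u} A)) (Q : ObjectProperty (ModuleCat.{u} B))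
    [P.IsClosedUnderIsomorphisms] [Q.IsClosedUnderIsomorphisms]
    (hP : P (ModuleCat.of A (LinearMap.ker β))) (hQ : Q (ModuleCat.of B Y))
    (hβ : Function.Surjective β) :
    classI U P Q (ModuleCat.of (TriMat A B U) (Triple β)) := by
  refine ⟨?_, Q.prop_of_iso (sndEquiv β).symm.toModuleIso hQ, ?_⟩
  · refine P.prop_of_iso (LinearEquiv.toModuleIso ?_) hP
    refine ((fstEquiv β).ofSubmodules _ _ ?_).symm
    ext x
    constructor
    · rintro ⟨m, hm, rfl⟩
      refine BimodHom.ext fun u => ?_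
      refine (sndEquiv_adj β m u).symm.trans ?_
      rw [show adj A B U (Triple β) m = 0 from hm]
      exact (sndEquiv β).map_zero
    · intro hx
      refine ⟨(fstEquiv β).symm x, ?_, (fstEquiv β).apply_symm_apply x⟩
      refine BimodHom.ext fun u => (sndEquiv β).injective ?_
      refine (sndEquiv_adj β _ u).trans ?_
      rw [LinearEquiv.apply_symm_apply, show β x = 0 from hx]
      exact (sndEquiv β).map_zero.symm
  · intro f
    obtain ⟨x, hx⟩ := hβ (BimodHom.map A U (sndEquiv β).toLinearMap f)
    refine ⟨(fstEquiv β).symm x, BimodHom.ext fun u => (sndEquiv β).injective ?_⟩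
    rw [sndEquiv_adj, LinearEquiv.apply_symm_apply, hx]
    rfl

end Triple

end Triple

end TriMat

/-! ### Resolutions as uniformly indexed exact sequences -/

section Sequences

variable {R : Type u} [Ring R] {P : ObjectProperty (ModuleCat.{u} R)} {m : ℕ}

/-- A coresolution of `M` as an exact sequence starting with `0 → M`. -/
lemma HasCoresolution.exists_exact {M : ModuleCat.{u} R} (h : HasCoresolution P m M) :
    ∃ (S : ℕ → ModuleCat.{u} R) (D : ∀ i, S i ⟶ S (i + 1)), S 1 = M ∧ Subsingleton (S 0) ∧
      (∀ i, i ≤ m → P (S (i + 2))) ∧ (∀ i, m < i → Subsingleton (S (i + 2))) ∧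
      ∀ i, Function.Exact (D i) (D (i + 1)) := by
  obtain ⟨X, d, η, hP, h0, hη, hex, hd⟩ := h
  -- With a zero module placed before `M`, injectivity of `η` becomes one more instance of
  -- exactness, so later arguments need no separate case at `M`.
  let S : ℕ → ModuleCat.{u} R
    | 0 => ModuleCat.of R PUnit
    | 1 => M
    | i + 2 => X i
  let D : ∀ i, S i ⟶ S (i + 1)
    | 0 => 0
    | 1 => η
    | i + 2 => d i
  refine ⟨S, D, rfl, inferInstanceAs (Subsingleton PUnit), hP, h0, ?_⟩
  rintro (_ | _ | i)
  · intro y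
    constructor
    · intro hy
      exact ⟨0, hη ((map_zero η.hom).trans hy.symm)⟩
    · rintro ⟨x, rfl⟩
      exact map_zero η.hom
  · exact hex
  · exact hd i

lemma HasCoresolution.of_exact (S : ℕ → ModuleCat.{u} R) (D : ∀ i, S i ⟶ S (i + 1))
    (h0 : Subsingleton (S 0)) (hP : ∀ i, i ≤ m → P (S (i + 2)))
    (hm : ∀ i, m < i → Subsingleton (S (i + 2))) (ex : ∀ i, Function.Exact (D i) (D (i + 1))) :
    HasCoresolution P m (S 1) := by
  refine ⟨fun i => S (i + 2), fun i => D (i + 2), D 1, hP, hm, ?_, ex 1, fun i => ex (i + 2)⟩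
  refine (injective_iff_map_eq_zero (D 1).hom).2 fun x hx => ?_
  obtain ⟨y, rfl⟩ := (ex 0 x).1 hx
  rw [Subsingleton.elim y 0]
  exact map_zero (D 0).hom

/-- A resolution of `M` as an exact sequence ending with `M → 0`. -/
lemma HasResolution.exists_exact {M : ModuleCat.{u} R} (h : HasResolution P m M) :
    ∃ (S : ℕ → ModuleCat.{u} R) (D : ∀ i, S (i + 1) ⟶ S i), S 1 = M ∧ Subsingleton (S 0) ∧
      (∀ i, i ≤ m → P (S (i + 2))) ∧ (∀ i, m < i → Subsingleton (S (i + 2))) ∧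
      ∀ i, Function.Exact (D (i + 1)) (D i) := by
  obtain ⟨X, d, ε, hP, h0, hε, hex, hd⟩ := h
  let S : ℕ → ModuleCat.{u} R
    | 0 => ModuleCat.of R PUnit
    | 1 => M
    | i + 2 => X i
  let D : ∀ i, S (i + 1) ⟶ S i
    | 0 => 0
    | 1 => ε
    | i + 2 => d i
  refine ⟨S, D, rfl, inferInstanceAs (Subsingleton PUnit), hP, h0, ?_⟩
  rintro (_ | _ | i)
  · exact fun y => ⟨fun _ => hε y, fun _ => rfl⟩
  · exact hex
  · exact hd i

lemma HasResolution.of_exact (S : ℕ → ModuleCat.{u} R) (D : ∀ i, S (i + 1) ⟶ S i)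
    (h0 : Subsingleton (S 0)) (hP : ∀ i, i ≤ m → P (S (i + 2)))
    (hm : ∀ i, m < i → Subsingleton (S (i + 2))) (ex : ∀ i, Function.Exact (D (i + 1)) (D i)) :
    HasResolution P m (S 1) :=
  ⟨fun i => S (i + 2), fun i => D (i + 2), D 1, hP, hm,
    fun x => (ex 0 x).1 (Subsingleton.elim _ _), ex 1, fun i => ex (i + 2)⟩

end Sequences

/-! ### Coresolutions of `Coker φ` and resolutions of `Ker φ~` -/

namespace TriMat

open Abelian

variable {A B U : Type u} [Ring A] [Ring B] [AddCommGroup U] [Module B U] [Module Aᵐᵒᵖ U]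
  [SMulCommClass B Aᵐᵒᵖ U]
  {C : ObjectProperty (ModuleCat.{u} A)} {E : ObjectProperty (ModuleCat.{u} B)} {m : ℕ}

instance (M : Type u) [AddCommGroup M] [Module (TriMat A B U) M] [Subsingleton M] :
    Subsingleton (fst A B U M) := Subtype.val_injective.subsingleton

instance (M : Type u) [AddCommGroup M] [Module (TriMat A B U) M] [Subsingleton M] :
    Subsingleton (snd A B U M) := Subtype.val_injective.subsingleton

/-- A `𝔓`-coresolution of `M` induces a coresolution of `Coker φ`, provided that `U ⊗_A -` keeps
the sequence of upper components exact. -/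
lemma hasCoresolution_coker {M : ModuleCat.{u} (TriMat A B U)}
    (h : HasCoresolution (classP U C E) m M) {N : ℕ} (hN : m ≤ N)
    (hC : ∀ X, C X → ∀ W : ModuleCat.{u} B, Injective W → ∀ j, 1 ≤ j → j ≤ N →
      Subsingleton (Ext X (bimodHomObj A U W) j)) :
    Function.Injective (str A B U M) ∧
      HasCoresolution E m (ModuleCat.of B (snd A B U M ⧸ LinearMap.range (str A B U M))) := by
  obtain ⟨S, D, rfl, h0, hP, hm, ex⟩ := h.exists_exact
  have exT (i : ℕ) : Function.Exact (BimodTensor.map A B U (fstMap (D i).hom))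
      (BimodTensor.map A B U (fstMap (D (i + 1)).hom)) := by
    refine BimodTensor.exact_map (fstMap_exact (ex i)) fun W hW => ?_
    refine subsingleton_ext_quotient_range (fun i => (fstFunctor A B U).obj (S i))
      (fun i => (fstFunctor A B U).map (D i)) (fun i => fstMap_exact (ex i)) _ N m
      (fun i hi j hj hjN => hC _ (hP i hi).1 W hW j hj hjN) (fun i hi => ?_) m (i + 1) 1
      (by omega) le_rfl (by omega)
    have := hm i hi
    exact inferInstanceAs (Subsingleton (fst A B U (S (i + 2))))
  have inj_add_two (i : ℕ) : Function.Injective (str A B U (S (i + 2))) := by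
    by_cases hi : i ≤ m
    · exact (hP i hi).2.2
    · have := hm i (by omega)
      have : Subsingleton (BimodTensor A B U (fst A B U (S (i + 2)))) := BimodTensor.subsingleton
      exact Function.injective_of_subsingleton _
  -- An element of `ker φ` on `S 1` dies in `U ⊗ (S 2)₁`, because `φ` is injective there; by
  -- exactness it comes from `U ⊗ (S 0)₁ = 0`.
  have inj_one : Function.Injective (str A B U (S 1)) := by
    refine (injective_iff_map_eq_zero _).2 fun t ht => ?_
    have h₁ := str_naturality_apply (D 1).hom t
    rw [ht, map_zero] at h₁
    have h₂ := inj_add_two 0 (h₁.symm.trans (map_zero _).symm)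
    obtain ⟨s, rfl⟩ := (exT 0 t).1 h₂
    have : Subsingleton (BimodTensor A B U (fst A B U (S 0))) := BimodTensor.subsingleton
    rw [Subsingleton.elim s 0, map_zero]
  refine ⟨inj_one, ?_⟩
  have hr (i : ℕ) : LinearMap.range (str A B U (S i)) ≤
      (LinearMap.range (str A B U (S (i + 1)))).comap (sndMap (D i).hom) := by
    rintro _ ⟨t, rfl⟩
    exact ⟨_, (str_naturality_apply (D i).hom t).symm⟩
  refine HasCoresolution.of_exact
    (fun i => ModuleCat.of B (snd A B U (S i) ⧸ LinearMap.range (str A B U (S i))))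
    (fun i => ModuleCat.ofHom (Submodule.mapQ _ _ (sndMap (D i).hom) (hr i))) ?_
    (fun i hi => (hP i hi).2.1) (fun i hi => ?_) (fun i w => ?_)
  · exact (Submodule.mkQ_surjective _).subsingleton
  · have := hm i hi
    exact (Submodule.mkQ_surjective _).subsingleton
  · have exS (i : ℕ) := sndMap_exact (ex i)
    constructor
    · intro hw
      obtain ⟨p, rfl⟩ := Submodule.Quotient.mk_surjective _ w
      obtain ⟨t, ht⟩ := (Submodule.Quotient.mk_eq_zero _).1 hw
      have h₁ : str A B U (S (i + 3)) (BimodTensor.map A B U (fstMap (D (i + 2)).hom) t) = 0 := by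
        rw [← str_naturality_apply, ht]
        exact (exS (i + 1)).apply_apply_eq_zero p
      have h₂ := inj_add_two (i + 1) (h₁.trans (map_zero _).symm)
      obtain ⟨s, rfl⟩ := (exT (i + 1) t).1 h₂
      -- Injectivity of `φ` two places further on makes `t` a cycle of the exact tensored sequence,
      -- so `t` lifts to `s`. Correcting the representative `p` by `φ(s)` makes it a genuine cycle.
      have h₃ : sndMap (D (i + 1)).hom (p - str A B U (S (i + 1)) s) = 0 := by
        rw [map_sub, str_naturality_apply, ← ht, sub_self]
      obtain ⟨q, hq⟩ := (exS i _).1 h₃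
      refine ⟨Submodule.Quotient.mk q, ?_⟩
      refine (Submodule.Quotient.eq _).2 ?_
      rw [hq]
      exact ⟨-s, by rw [map_neg]; abel⟩
    · rintro ⟨q, rfl⟩
      obtain ⟨q, rfl⟩ := Submodule.Quotient.mk_surjective _ q
      refine (Submodule.Quotient.mk_eq_zero _).2 ?_
      rw [(exS i).apply_apply_eq_zero q]
      exact Submodule.zero_mem _

/-- `Hom_B(U, -)` preserves exactness at `Y` of `X → Y → Z` as soon as
`Ext¹_B(U, Ker (X → Y)) = 0`. -/
lemma _root_.BimodHom.exact_map {X Y Z : Type u} [AddCommGroup X] [Module B X] [AddCommGroup Y]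
    [Module B Y] [AddCommGroup Z] [Module B Z] {f : X →ₗ[B] Y} {g : Y →ₗ[B] Z}
    (h : Function.Exact f g)
    (hU : Subsingleton (Ext (ModuleCat.of B U) (ModuleCat.of B (LinearMap.ker f)) 1)) :
    Function.Exact (BimodHom.map A U f) (BimodHom.map A U g) := by
  intro k
  constructor
  · intro hk
    have hk' (v : U) : k v ∈ LinearMap.range f :=
      (h _).1 (congrArg (fun l : BimodHom B U Z => l v) hk)
    -- A map killed by `g` has values in `im f`, and lifts along `X → im f` because `Ext¹(U, ker f)
    -- = 0`.
    let T : ShortComplex (ModuleCat.{u} B) := f.rangeRestrict.shortComplexKer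
    have hT : T.ShortExact := LinearMap.shortExact_shortComplexKer f.surjective_rangeRestrict
    have : Subsingleton (Ext (ModuleCat.of B U) T.X₁ 1) := by
      have e : LinearMap.ker f.rangeRestrict = LinearMap.ker f := LinearMap.ker_rangeRestrict f
      change Subsingleton (Ext (ModuleCat.of B U)
        (ModuleCat.of B (LinearMap.ker f.rangeRestrict)) 1)
      rwa [e]
    obtain ⟨l, hl⟩ := exists_lift_of_ext_one hT (ModuleCat.of B U)
      (ModuleCat.ofHom (k.toLin.codRestrict _ hk'))
    refine ⟨show U →ₗ[B] X from l.hom, BimodHom.ext fun v => ?_⟩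
    exact congrArg (fun q : ModuleCat.of B U ⟶ T.X₃ => ((q v : LinearMap.range f) : Y)) hl
  · rintro ⟨l, rfl⟩
    exact BimodHom.ext fun v => h.apply_apply_eq_zero (l v)

/-- An `ℑ`-resolution of `M` induces a resolution of `Ker φ~`, provided that `Hom_B(U, -)` keeps
the sequence of lower components exact. -/
lemma hasResolution_ker {M : ModuleCat.{u} (TriMat A B U)}
    (h : HasResolution (classI U C E) m M) {N : ℕ} (hN : m ≤ N)
    (hE : ∀ Y, E Y → ∀ j, 1 ≤ j → j ≤ N → Subsingleton (Ext (ModuleCat.of B U) Y j)) :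
    Function.Surjective (adj A B U M) ∧
      HasResolution C m (ModuleCat.of A (LinearMap.ker (adj A B U M))) := by
  obtain ⟨S, D, rfl, h0, hP, hm, ex⟩ := h.exists_exact
  have exH (i : ℕ) : Function.Exact (BimodHom.map A U (sndMap (D (i + 1)).hom))
      (BimodHom.map A U (sndMap (D i).hom)) := by
    refine BimodHom.exact_map (sndMap_exact (ex i)) ?_
    refine subsingleton_ext_ker (fun i => (sndFunctor A B U).obj (S i))
      (fun i => (sndFunctor A B U).map (D i)) (fun i => sndMap_exact (ex i)) _ N m
      (fun i hi j hj hjN => hE _ (hP i hi).2.1 j hj hjN) (fun i hi => ?_) m (i + 1) 1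
      (by omega) le_rfl (by omega)
    have := hm i hi
    exact inferInstanceAs (Subsingleton (snd A B U (S (i + 2))))
  have subs (M : Type u) [AddCommGroup M] [Module (TriMat A B U) M] [Subsingleton M] :
      Subsingleton (BimodHom B U (snd A B U M)) :=
    ⟨fun _ _ => BimodHom.ext fun _ => Subsingleton.elim _ _⟩
  have surj_add_two (i : ℕ) : Function.Surjective (adj A B U (S (i + 2))) := by
    by_cases hi : i ≤ m
    · exact (hP i hi).2.2
    · have := hm i (by omega)
      have := subs (S (i + 2))
      exact Function.surjective_to_subsingleton _
  -- Since `Hom(U, (S 0)₂) = 0`, every `k` lifts to `Hom(U, (S 2)₂)`, where `φ~` is already onto.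
  have surj_one : Function.Surjective (adj A B U (S 1)) := by
    intro k
    have := subs (S 0)
    obtain ⟨l, rfl⟩ := (exH 0 k).1 (Subsingleton.elim _ _)
    obtain ⟨x, rfl⟩ := surj_add_two 0 l
    exact ⟨_, (adj_naturality_apply (D 1).hom x).symm⟩
  refine ⟨surj_one, ?_⟩
  have hr (i : ℕ) (x) (hx : x ∈ LinearMap.ker (adj A B U (S (i + 1)))) :
      fstMap (D i).hom x ∈ LinearMap.ker (adj A B U (S i)) := by
    rw [LinearMap.mem_ker, ← adj_naturality_apply, LinearMap.mem_ker.1 hx, map_zero]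
  refine HasResolution.of_exact
    (fun i => ModuleCat.of A (LinearMap.ker (adj A B U (S i))))
    (fun i => ModuleCat.ofHom ((fstMap (D i).hom).restrict (hr i))) ?_
    (fun i hi => (hP i hi).1) (fun i hi => ?_) (fun i w => ?_)
  · exact Subtype.val_injective.subsingleton
  · have := hm i hi
    exact Subtype.val_injective.subsingleton
  · have exS (i : ℕ) := fstMap_exact (ex i)
    constructor
    · intro hw
      obtain ⟨x, hx⟩ := w
      obtain ⟨y, rfl⟩ := (exS i x).1 (congrArg Subtype.val hw)
      have h₁ : BimodHom.map A U (sndMap (D (i + 1)).hom) (adj A B U (S (i + 2)) y) = 0 := by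
        rw [adj_naturality_apply]
        exact hx
      obtain ⟨l, hl⟩ := (exH (i + 1) _).1 h₁
      obtain ⟨z, rfl⟩ := surj_add_two (i + 1) l
      -- The preimage `y` need not lie in `Ker φ~`. Exactness of the `Hom` sequence and surjectivity
      -- of `φ~` on `S (i + 3)` give `z` whose image has the same `φ~`; subtracting that boundary
      -- does not change the image of `y`.
      refine ⟨⟨y - fstMap (D (i + 2)).hom z, ?_⟩, Subtype.ext ?_⟩
      · rw [LinearMap.mem_ker, map_sub, ← adj_naturality_apply, hl, sub_self]
      · change fstMap (D (i + 1)).hom (y - fstMap (D (i + 2)).hom z) = fstMap (D (i + 1)).hom y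
        rw [map_sub, (exS (i + 1)).apply_apply_eq_zero z, sub_zero]
    · rintro ⟨q, rfl⟩
      exact Subtype.ext ((exS i).apply_apply_eq_zero q.1)

end TriMat

/-! ### Short exact sequences with an end replaced by an isomorphic module -/

section ShortExact

variable {R : Type u} [Ring R]

lemma shortExact_precomp_iso {M X Y Z : ModuleCat.{u} R} (e : M ≅ X) {f : X ⟶ Y} {g : Y ⟶ Z}
    {w : f ≫ g = 0} (h : (ShortComplex.mk f g w).ShortExact) :
    (ShortComplex.mk (e.hom ≫ f) g (by rw [Category.assoc, w, Limits.comp_zero])).ShortExact :=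
  ShortComplex.shortExact_of_iso
    (ShortComplex.isoMk e.symm (Iso.refl Y) (Iso.refl Z) (by simp) (by simp)) h

lemma shortExact_postcomp_iso {M X Y Z : ModuleCat.{u} R} (e : Z ≅ M) {f : X ⟶ Y} {g : Y ⟶ Z}
    {w : f ≫ g = 0} (h : (ShortComplex.mk f g w).ShortExact) :
    (ShortComplex.mk f (g ≫ e.hom) (by rw [← Category.assoc, w, Limits.zero_comp])).ShortExact :=
  ShortComplex.shortExact_of_iso
    (ShortComplex.isoMk (Iso.refl X) (Iso.refl Y) e (by simp) (by simp)) h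

end ShortExact

namespace TriMat

open Abelian

variable {A B U : Type u} [Ring A] [Ring B] [AddCommGroup U] [Module B U] [Module Aᵐᵒᵖ U]
  [SMulCommClass B Aᵐᵒᵖ U]

/-! ### Closure under summands passes to the component classes -/

section Summands

variable {C : ObjectProperty (ModuleCat.{u} A)} {E : ObjectProperty (ModuleCat.{u} B)}
  [C.IsClosedUnderIsomorphisms] [E.IsClosedUnderIsomorphisms]
  (hs : ClosedUnderSummands (classA U C E))

include hs

/-- Zero is a summand of any member, via `M ≃ 0 × M`. A member `M` must be supplied, since the empty
class is also closed under summands. -/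
lemma classA_of_subsingleton {M : ModuleCat.{u} (TriMat A B U)} (hM : classA U C E M)
    (Z : ModuleCat.{u} (TriMat A B U)) [Subsingleton Z] : classA U C E Z := by
  let : Unique Z := uniqueOfSubsingleton 0
  exact hs Z M M hM ⟨LinearEquiv.uniqueProd.symm⟩

lemma fst_mem_of_subsingleton {M : ModuleCat.{u} (TriMat A B U)} (hM : classA U C E M)
    (X : ModuleCat.{u} A) [Subsingleton X] : C X := by
  have : Subsingleton ((inclA A B U).obj X) := inferInstanceAs (Subsingleton X)
  exact C.prop_of_iso ((inclACompFst A B U).app X) (classA_of_subsingleton hs hM _).1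

lemma snd_mem_of_subsingleton {M : ModuleCat.{u} (TriMat A B U)} (hM : classA U C E M)
    (Y : ModuleCat.{u} B) [Subsingleton Y] : E Y := by
  have : Subsingleton ((inclB A B U).obj Y) := inferInstanceAs (Subsingleton Y)
  exact E.prop_of_iso ((inclBCompSnd A B U).app Y) (classA_of_subsingleton hs hM _).2

/-- The second component is zero, so this rests on zero modules belonging to `E`. -/
lemma classA_inclA {M : ModuleCat.{u} (TriMat A B U)} (hM : classA U C E M)
    {X : ModuleCat.{u} A} (hX : C X) : classA U C E ((inclA A B U).obj X) :=
  ⟨C.prop_of_iso ((inclACompFst A B U).app X).symm hX, snd_mem_of_subsingleton hs hM _⟩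

lemma classA_inclB {M : ModuleCat.{u} (TriMat A B U)} (hM : classA U C E M)
    {Y : ModuleCat.{u} B} (hY : E Y) : classA U C E ((inclB A B U).obj Y) :=
  ⟨fst_mem_of_subsingleton hs hM _, E.prop_of_iso ((inclBCompSnd A B U).app Y).symm hY⟩

lemma closedUnderSummands_fst {M : ModuleCat.{u} (TriMat A B U)} (hM : classA U C E M) :
    ClosedUnderSummands C := by
  rintro X Y Z hZ ⟨e⟩
  let e' : (inclA A B U).obj Z ≃ₗ[TriMat A B U] (inclA A B U).obj X × (inclA A B U).obj Y :=
    { e with map_smul' := fun r z => e.map_smul r.a z }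
  exact C.prop_of_iso ((inclACompFst A B U).app X) (hs _ _ _ (classA_inclA hs hM hZ) ⟨e'⟩).1

lemma closedUnderSummands_snd {M : ModuleCat.{u} (TriMat A B U)} (hM : classA U C E M) :
    ClosedUnderSummands E := by
  rintro X Y Z hZ ⟨e⟩
  let e' : (inclB A B U).obj Z ≃ₗ[TriMat A B U] (inclB A B U).obj X × (inclB A B U).obj Y :=
    { e with map_smul' := fun r z => e.map_smul r.b z }
  exact E.prop_of_iso ((inclBCompSnd A B U).app X) (hs _ _ _ (classA_inclB hs hM hZ) ⟨e'⟩).2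

end Summands

section Components

variable {C : ObjectProperty (ModuleCat.{u} A)} {E : ObjectProperty (ModuleCat.{u} B)} {m : ℕ}
  {M : ModuleCat.{u} (TriMat A B U)}

lemma hasCoresolution_fst (h : HasCoresolution (classP U C E) m M) :
    HasCoresolution C m (ModuleCat.of A (fst A B U M)) := by
  obtain ⟨X, d, η, hP, h0, hη, hex, hd⟩ := h
  refine ⟨fun i => (fstFunctor A B U).obj (X i), fun i => (fstFunctor A B U).map (d i),
    (fstFunctor A B U).map η, fun i hi => (hP i hi).1, fun i hi => ?_, fstMap_injective hη,
    fstMap_exact hex, fun i => fstMap_exact (hd i)⟩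
  have := h0 i hi
  exact inferInstanceAs (Subsingleton (fst A B U (X i)))

lemma hasResolution_snd (h : HasResolution (classI U C E) m M) :
    HasResolution E m (ModuleCat.of B (snd A B U M)) := by
  obtain ⟨X, d, ε, hP, h0, hε, hex, hd⟩ := h
  refine ⟨fun i => (sndFunctor A B U).obj (X i), fun i => (sndFunctor A B U).map (d i),
    (sndFunctor A B U).map ε, fun i hi => (hP i hi).2.1, fun i hi => ?_, sndMap_surjective hε,
    sndMap_exact hex, fun i => sndMap_exact (hd i)⟩
  have := h0 i hi
  exact inferInstanceAs (Subsingleton (snd A B U (X i)))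

end Components

/-! ### Standard members of `𝔓` and `ℑ`, and descent of Ext-vanishing -/

section StandardModules

variable {C : ObjectProperty (ModuleCat.{u} A)} {E : ObjectProperty (ModuleCat.{u} B)}
  [C.IsClosedUnderIsomorphisms] [E.IsClosedUnderIsomorphisms]
  {X : ModuleCat.{u} A} {Y : ModuleCat.{u} B}

variable (U X Y) in
/-- The structure map of the module `(X, U ⊗ X ⊕ Y)`. -/
abbrev tensorStr : X →ₗ[A] BimodHom B U (BimodTensor A B U X × Y) :=
  BimodTensor.curry (LinearMap.inl B (BimodTensor A B U X) Y)

variable (U X Y) in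
/-- The adjoint structure map of the module `(Hom(U, Y) ⊕ X, Y)`. -/
abbrev homStr : (BimodHom B U Y × X) →ₗ[A] BimodHom B U Y :=
  LinearMap.fst A (BimodHom B U Y) X

variable (U X Y) in
/-- The module `(X, U ⊗ X ⊕ Y)`. -/
abbrev tensorTriple : ModuleCat.{u} (TriMat A B U) :=
  ModuleCat.of (TriMat A B U) (Triple (tensorStr U X Y))

variable (U X Y) in
/-- The module `(Hom(U, Y) ⊕ X, Y)`. -/
abbrev homTriple : ModuleCat.{u} (TriMat A B U) :=
  ModuleCat.of (TriMat A B U) (Triple (homStr U X Y))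

lemma classP_tensorTriple (hX : C X) (hY : E Y) : classP U C E (tensorTriple U X Y) := by
  have h : BimodTensor.lift (tensorStr U X Y) = LinearMap.inl B (BimodTensor A B U X) Y :=
    BimodTensor.lift_curry _
  refine Triple.classP_of _ C E hX (E.prop_of_iso (LinearEquiv.toModuleIso ?_) hY) ?_
  · exact ((Submodule.quotEquivOfEq _ _ (by rw [h, LinearMap.ker_snd])).trans
      ((LinearMap.snd B (BimodTensor A B U X) Y).quotKerEquivOfSurjective
        LinearMap.snd_surjective)).symm
  · rw [h]
    exact LinearMap.inl_injective

lemma classI_homTriple (hX : C X) (hY : E Y) : classI U C E (homTriple U X Y) := by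
  refine Triple.classI_of _ C E (C.prop_of_iso (LinearEquiv.toModuleIso ?_) hX) hY
    LinearMap.fst_surjective
  exact (LinearEquiv.ofInjective (LinearMap.inr A (BimodHom B U Y) X)
    LinearMap.inr_injective).trans (LinearEquiv.ofEq _ _ (LinearMap.ker_fst ..).symm)

/-- The projection to `(X, 0)` is an isomorphism on first components. The summand `Y` is arbitrary
and only serves to place the triple in `𝔓`. -/
lemma subsingleton_ext_fst_of_tensorTriple {Z : ModuleCat.{u} A} {i : ℕ}
    (h : Subsingleton (Ext (tensorTriple U X Y) ((inclA A B U).obj Z) i)) :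
    Subsingleton (Ext X Z i) := by
  let p : Triple (tensorStr U X Y) →ₗ[TriMat A B U] (inclA A B U).obj X :=
    { toFun := fun m => m.1
      map_add' := fun _ _ => rfl
      map_smul' := fun _ _ => rfl }
  exact subsingleton_ext_of_section (inclA A B U) (fstFunctor A B U) (inclACompFst A B U)
    (N := tensorTriple U X Y) (ConcreteCategory.ofHom p)
    (ModuleCat.ofHom (Triple.fstEquiv (tensorStr U X Y)).symm.toLinearMap) rfl

/-- Since `φ` lands in the summand `U ⊗ X`, projecting to `Y` is `Λ`-linear; on second components
the inclusion of `Y` is a section. -/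
lemma subsingleton_ext_snd_of_tensorTriple {Z : ModuleCat.{u} B} {i : ℕ}
    (h : Subsingleton (Ext (tensorTriple U X Y) ((inclB A B U).obj Z) i)) :
    Subsingleton (Ext Y Z i) := by
  let p : Triple (tensorStr U X Y) →ₗ[TriMat A B U] (inclB A B U).obj Y :=
    { toFun := fun m => m.2.2
      map_add' := fun _ _ => rfl
      map_smul' := fun r m => zero_add (r.b • m.2.2) }
  exact subsingleton_ext_of_section (inclB A B U) (sndFunctor A B U) (inclBCompSnd A B U)
    (N := tensorTriple U X Y) (ConcreteCategory.ofHom p)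
    (ModuleCat.ofHom ((Triple.sndEquiv (tensorStr U X Y)).symm.toLinearMap ∘ₗ
      LinearMap.inr B (BimodTensor A B U X) Y)) rfl

lemma subsingleton_ext_snd_of_homTriple {Z : ModuleCat.{u} B} {i : ℕ}
    (h : Subsingleton (Ext ((inclB A B U).obj Z) (homTriple U X Y) i)) :
    Subsingleton (Ext Z Y i) := by
  let j : (inclB A B U).obj Y →ₗ[TriMat A B U] Triple (homStr U X Y) :=
    { toFun := fun y => ((0, y) : (BimodHom B U Y × X) × Y)
      map_add' := fun x y => Prod.ext (zero_add 0).symm rfl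
      map_smul' := fun r y => Prod.ext (smul_zero r.a).symm (zero_add _).symm }
  exact subsingleton_ext_of_retraction (inclB A B U) (sndFunctor A B U) (inclBCompSnd A B U)
    (N := homTriple U X Y) (ConcreteCategory.ofHom j)
    (ModuleCat.ofHom (Triple.sndEquiv (homStr U X Y)).toLinearMap) rfl

/-- Since `φ~` kills the summand `X`, the inclusion of `(X, 0)` is `Λ`-linear; on first components
the projection to `X` retracts it. -/
lemma subsingleton_ext_fst_of_homTriple {Z : ModuleCat.{u} A} {i : ℕ}
    (h : Subsingleton (Ext ((inclA A B U).obj Z) (homTriple U X Y) i)) :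
    Subsingleton (Ext Z X i) := by
  let j : (inclA A B U).obj X →ₗ[TriMat A B U] Triple (homStr U X Y) :=
    { toFun := fun x => (((0, x), 0) : (BimodHom B U Y × X) × Y)
      map_add' := fun x y => Prod.ext (Prod.ext (zero_add 0).symm rfl) (zero_add 0).symm
      map_smul' := fun r x => Prod.ext (Prod.ext (smul_zero r.a).symm rfl)
        ((zero_add _).trans (smul_zero r.b)).symm }
  exact subsingleton_ext_of_retraction (inclA A B U) (fstFunctor A B U) (inclACompFst A B U)
    (N := homTriple U X Y) (ConcreteCategory.ofHom j)
    (ModuleCat.ofHom (LinearMap.snd A (BimodHom B U Y) X ∘ₗ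
      (Triple.fstEquiv (homStr U X Y)).toLinearMap)) rfl

end StandardModules

/-! ### Right cotorsion pairs -/

section Right

variable {C D : ObjectProperty (ModuleCat.{u} A)} {E F : ObjectProperty (ModuleCat.{u} B)}
  [C.IsClosedUnderIsomorphisms] [D.IsClosedUnderIsomorphisms]
  [E.IsClosedUnderIsomorphisms] [F.IsClosedUnderIsomorphisms] {n : ℕ}
  (h : IsRightCotorsionPair n (classP U C E) (classA U D F))

include h

/-- The approximation of the zero module supplies members of both classes; the one in `𝔓` is the
term of index `0` of the coresolution. They provide the fixed other component of the triples tested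
for orthogonality and show that zero lies in `D` and `F`. -/
lemma exists_mem_of_isRightCotorsionPair :
    (∃ M, classP U C E M) ∧ ∃ M, classA U D F M := by
  obtain ⟨Y, X, -, -, -, -, hY, k, -, S, -, -, hS, -⟩ :=
    h.exists_sequence (ModuleCat.of (TriMat A B U) PUnit)
  exact ⟨⟨_, hS 0 (Nat.zero_le k)⟩, ⟨Y, hY⟩⟩

lemma isRightCotorsionPair_fst : IsRightCotorsionPair n C D := by
  obtain ⟨⟨P, hP⟩, ⟨Q, hQ⟩⟩ := exists_mem_of_isRightCotorsionPair h
  refine ⟨closedUnderSummands_fst h.summands hQ, fun X Y hX hY i hi hin => ?_, fun M => ?_⟩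
  · exact subsingleton_ext_fst_of_tensorTriple <|
      h.ext_eq_zero _ _ (classP_tensorTriple hX hP.2.1) (classA_inclA h.summands hQ hY) i hi hin
  · obtain ⟨Y, X, f, g, w, hse, hY, k, hk, hX⟩ := h.exists_sequence ((inclA A B U).obj M)
    exact ⟨_, _, _, _, _, shortExact_precomp_iso ((inclACompFst A B U).symm.app M)
      (hse.map_of_exact (fstFunctor A B U)), hY.1, k, hk, hasCoresolution_fst hX⟩

lemma isRightCotorsionPair_snd
    (hTor : ∀ j, 1 ≤ j → j ≤ n + 1 → ∀ X, C X → Limits.IsZero (bimodTor A B U j X))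
    (hext : (coresdimLE E (n - 1)).IsClosedUnderExtensions)
    (hD : ∀ X, D X → coresdimLE E (n - 1) ((bimodTensorFunctor A B U).obj X)) :
    IsRightCotorsionPair n E F := by
  obtain ⟨⟨P, hP⟩, ⟨Q, hQ⟩⟩ := exists_mem_of_isRightCotorsionPair h
  refine ⟨closedUnderSummands_snd h.summands hQ, fun X Y hX hY i hi hin => ?_, fun M => ?_⟩
  · exact subsingleton_ext_snd_of_tensorTriple <|
      h.ext_eq_zero _ _ (classP_tensorTriple hP.1 hX) (classA_inclB h.summands hQ hY) i hi hin
  · obtain ⟨Y, X, f, g, w, hse, hY, k, hk, hX⟩ := h.exists_sequence ((inclB A B U).obj M)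
    refine ⟨_, _, _, _, _, shortExact_precomp_iso ((inclBCompSnd A B U).symm.app M)
      (hse.map_of_exact (sndFunctor A B U)), hY.2, ?_⟩
    -- The coresolution has length `k ≤ n - 1`, well within the range `n + 1` of the Tor hypothesis.
    obtain ⟨hinj, hcok⟩ := hasCoresolution_coker hX (N := n + 1) (by omega)
      fun Z hZ W hW j hj hjn => by
        obtain ⟨p, rfl⟩ := Nat.exists_eq_add_of_le' hj
        exact subsingleton_ext_of_isZero_bimodTor (hTor (p + 1) hj hjn Z hZ) W hW
    -- The first component of `(0, M)` vanishes, so `Y₁ ≅ X₁`; this brings `X₁` into `D` and makes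
    -- the hypothesis on `U ⊗ D` applicable.
    have hg : Function.Bijective (fstMap g.hom) := by
      refine ⟨(injective_iff_map_eq_zero _).2 fun y hy => ?_,
        fstMap_surjective hse.moduleCat_surjective_g⟩
      obtain ⟨x, rfl⟩ := (fstMap_exact
        ((ShortComplex.ShortExact.moduleCat_exact_iff_function_exact _).1 hse.exact) y).1 hy
      rw [Subsingleton.elim x 0, map_zero]
    have hDX : D (ModuleCat.of A (fst A B U X)) :=
      D.prop_of_iso (LinearEquiv.ofBijective _ hg).toModuleIso hY.1
    let T : ShortComplex (ModuleCat.{u} B) :=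
      ShortComplex.mk (ModuleCat.ofHom (str A B U X))
        (ModuleCat.ofHom (LinearMap.range (str A B U X)).mkQ) (by
          ext1
          exact LinearMap.range_mkQ_comp _)
    have hT : T.ShortExact := ModuleCat.shortComplex_shortExact _
      (LinearMap.exact_map_mkQ_range _) hinj (Submodule.mkQ_surjective _)
    -- `X₂` is the middle term of `0 → U ⊗ X₁ → X₂ → Coker φ → 0`.
    exact hext.prop_X₂_of_shortExact hT (hD _ hDX) ⟨k, hk, hcok⟩

end Right

/-! ### Left cotorsion pairs -/

section Left

variable {C D : ObjectProperty (ModuleCat.{u} A)} {E F : ObjectProperty (ModuleCat.{u} B)}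
  [C.IsClosedUnderIsomorphisms] [D.IsClosedUnderIsomorphisms]
  [E.IsClosedUnderIsomorphisms] [F.IsClosedUnderIsomorphisms] {n : ℕ}
  (h : IsLeftCotorsionPair n (classA U C E) (classI U D F))

include h

lemma exists_mem_of_isLeftCotorsionPair :
    (∃ M, classA U C E M) ∧ ∃ M, classI U D F M := by
  obtain ⟨Y, X, -, -, -, -, hX, k, -, S, -, -, hS, -⟩ :=
    h.exists_sequence (ModuleCat.of (TriMat A B U) PUnit)
  exact ⟨⟨X, hX⟩, ⟨_, hS 0 (Nat.zero_le k)⟩⟩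

lemma isLeftCotorsionPair_snd : IsLeftCotorsionPair n E F := by
  obtain ⟨⟨P, hP⟩, ⟨Q, hQ⟩⟩ := exists_mem_of_isLeftCotorsionPair h
  refine ⟨closedUnderSummands_snd h.summands hP, fun X Y hX hY i hi hin => ?_, fun M => ?_⟩
  · exact subsingleton_ext_snd_of_homTriple <|
      h.ext_eq_zero _ _ (classA_inclB h.summands hP hX) (classI_homTriple hQ.1 hY) i hi hin
  · obtain ⟨Y, X, f, g, w, hse, hX, k, hk, hY⟩ := h.exists_sequence ((inclB A B U).obj M)
    exact ⟨_, _, _, _, _, shortExact_postcomp_iso ((inclBCompSnd A B U).app M)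
      (hse.map_of_exact (sndFunctor A B U)), hX.2, k, hk, hasResolution_snd hY⟩

lemma isLeftCotorsionPair_fst
    (hExt : ∀ j, 1 ≤ j → j ≤ n + 1 → ∀ Y, F Y → Subsingleton (Ext (ModuleCat.of B U) Y j))
    (hext : (resdimLE D (n - 1)).IsClosedUnderExtensions)
    (hE : ∀ Y, E Y → resdimLE D (n - 1) (ModuleCat.of A (BimodHom B U Y))) :
    IsLeftCotorsionPair n C D := by
  obtain ⟨⟨P, hP⟩, ⟨Q, hQ⟩⟩ := exists_mem_of_isLeftCotorsionPair h
  refine ⟨closedUnderSummands_fst h.summands hP, fun X Y hX hY i hi hin => ?_, fun M => ?_⟩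
  · exact subsingleton_ext_fst_of_homTriple <|
      h.ext_eq_zero _ _ (classA_inclA h.summands hP hX) (classI_homTriple hY hQ.2.1) i hi hin
  · obtain ⟨Y, X, f, g, w, hse, hX, k, hk, hY⟩ := h.exists_sequence ((inclA A B U).obj M)
    refine ⟨_, _, _, _, _, shortExact_postcomp_iso ((inclACompFst A B U).app M)
      (hse.map_of_exact (fstFunctor A B U)), hX.1, ?_⟩
    obtain ⟨hsurj, hker⟩ := hasResolution_ker hY (N := n + 1) (by omega)
      fun Z hZ j hj hjn => hExt j hj hjn Z hZ
    -- The second component of `(M, 0)` vanishes, so `Y₂ ≅ X₂` lies in `E`.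
    have hf : Function.Bijective (sndMap f.hom) := by
      refine ⟨sndMap_injective hse.moduleCat_injective_f, fun y => ?_⟩
      exact (sndMap_exact
        ((ShortComplex.ShortExact.moduleCat_exact_iff_function_exact _).1 hse.exact) y).1
        (Subsingleton.elim _ _)
    have hEY : E (ModuleCat.of B (snd A B U Y)) :=
      E.prop_of_iso (LinearEquiv.ofBijective _ hf).symm.toModuleIso hX.2
    -- `Y₁` is the middle term of `0 → Ker φ~ → Y₁ → Hom(U, Y₂) → 0`.
    exact hext.prop_X₂_of_shortExact (LinearMap.shortExact_shortComplexKer hsurj)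
      ⟨k, hk, hker⟩ (hE _ hEY)

end Left

end TriMat

theorem theorem3p8 (A B U : Type u) [Ring A] [Ring B] [AddCommGroup U] [Module B U]
    [Module Aᵐᵒᵖ U] [SMulCommClass B Aᵐᵒᵖ U] (n : ℕ) (hn : 1 ≤ n)
    (C D : ObjectProperty (ModuleCat.{u} A)) (E F : ObjectProperty (ModuleCat.{u} B))
    [C.IsClosedUnderIsomorphisms] [D.IsClosedUnderIsomorphisms]
    [E.IsClosedUnderIsomorphisms] [F.IsClosedUnderIsomorphisms] :
    (IsRightCotorsionPair n (TriMat.classP U C E) (TriMat.classA U D F) →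
      (∀ j, 1 ≤ j → j ≤ n + 1 → ∀ X, C X → Limits.IsZero (bimodTor A B U j X)) →
      IsRightCotorsionPair n C D ∧
      ((coresdimLE E (n - 1)).IsClosedUnderExtensions →
        (∀ X, D X → coresdimLE E (n - 1) ((bimodTensorFunctor A B U).obj X)) →
        IsRightCotorsionPair n E F)) ∧
    (IsLeftCotorsionPair n (TriMat.classA U C E) (TriMat.classI U D F) →
      (∀ j, 1 ≤ j → j ≤ n + 1 → ∀ Y, F Y → Subsingleton (Abelian.Ext (ModuleCat.of B U) Y j)) →
      IsLeftCotorsionPair n E F ∧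
      ((resdimLE D (n - 1)).IsClosedUnderExtensions →
        (∀ Y, E Y → resdimLE D (n - 1) (ModuleCat.of A (BimodHom B U Y))) →
        IsLeftCotorsionPair n C D)) :=
  ⟨fun h hTor => ⟨TriMat.isRightCotorsionPair_fst h,
      fun hext hD => TriMat.isRightCotorsionPair_snd h hTor hext hD⟩,
    fun h hExt => ⟨TriMat.isLeftCotorsionPair_snd h,
      fun hext hE => TriMat.isLeftCotorsionPair_fst h hExt hext hE⟩⟩
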